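/- Let $\mathcal R=(R,<,+,0,\ldots)$ be a first-order structure expanding a densely linearly ordered abelian group; equip $R$ with the order topology and $R^n$ with the product topology, and let "definable" mean definable in $\mathcal R$ with parameters from $R$. Assume that - $\mathcal R$ is definably complete, i.e. every definable subset of $R$ has a supremum and an infimum in $R\cup\{\pm\infty\}$, and - every definable closed subset of $R$ is either discrete (in its subspace topology) or contains a nonempty open interval $(a,b)$, where $a<b$ are in $R$. A $\mathrm D_\Sigma$-family in $R^n$ is a family $\{X\langle r,s\rangle\}_{r>0,\,s>0}$ of closed, bounded, definable subsets of $R^n$ indexed by $r,s\in R$, for which there is a definable set $\mathcal X\subseteq R^{2+n}$ with $X\langle r,s\rangle=\{y\in R^n : (r,s,y)\in\mathcal X\}$ for all $r,s>0$, and such that for all positive $r,r',s,s'$ in $R$ $$X\langle r,s\rangle\subseteq X\langle r',s\rangle \text{ whenever } r<r',\qquad X\langle r,s'\rangle\subseteq X\langle r,s\rangle \text{ whenever } s<s'.$$ A definable set $X\subseteq R^n$ is a $\mathrm D_\Sigma$-set if $X=\bigcup_{r>0,\,s>0}X\langle r,s\rangle$ for some $\mathrm D_\Sigma$-family in $R^n$.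 Then, for every $n\ge 0$, every $\mathrm D_\Sigma$-set $X\subseteq R^n$ is constructible, i.e. it is a finite boolean combination of open subsets of $R^n$. -/

import Mathlib

open FirstOrder

section OrderedStructures

variable (L : Language) {R : Type*} [L.Structure R]

/-- The `L`-structure on the ordered abelian group `R` is an expansion of `(R, <, +, 0)`: the order
and the graph of addition are definable. Definable always means definable with parameters from
`R`, so it does not matter whether the order and the addition are themselves symbols of `L`, and
the constant `0` is definable anyway. -/
structure IsOrderedGroupExpansion [AddCommGroup R] [LinearOrder R] : Prop where
  definable_lt : (Set.univ : Set R).Definable L {v : Fin 2 → R | v 0 < v 1}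
  definable_add : (Set.univ : Set R).Definable L {v : Fin 3 → R | v 0 + v 1 = v 2}

variable (R) in
/-- Every definable subset of `R` has a supremum and an infimum in `R ∪ {±∞}`; the
supremum is infinite exactly for the empty set and for the sets unbounded above, and similarly
for the infimum. -/
def IsDefinablyComplete [LinearOrder R] : Prop :=
  ∀ X : Set R, (Set.univ : Set R).Definable₁ L X → X.Nonempty →
    (BddAbove X → ∃ a, IsLUB X a) ∧ (BddBelow X → ∃ a, IsGLB X a)

variable (R) in
/-- Every definable closed subset of `R` is discrete (in its subspace topology) or contains a
nonempty open interval. -/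
def ClosedDiscreteOrInterval [LinearOrder R] [TopologicalSpace R] : Prop :=
  ∀ X : Set R, (Set.univ : Set R).Definable₁ L X → IsClosed X →
    IsDiscrete X ∨ ∃ a b : R, a < b ∧ Set.Ioo a b ⊆ X

/-- Closed, bounded and definable subsets of `R ^ n`. Here `Set.Icc a b` is the closed box
`∏ i, [a i, b i]`. -/
structure IsCBD [LinearOrder R] [TopologicalSpace R] {n : ℕ} (X : Set (Fin n → R)) : Prop where
  isClosed : IsClosed X
  bounded : ∃ a b : Fin n → R, X ⊆ Set.Icc a b
  definable : (Set.univ : Set R).Definable L X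

/-- The family `X r s`, for `r > 0` and `s > 0`, is a `D_Σ`-family of subsets of `R ^ n`: a
parameterized family of closed, bounded, definable sets (the fibers over the `(r, s)` of one
definable subset of `R ^ (2 + n)`) increasing in `r` and decreasing in `s`. The values of `X`
outside `r > 0`, `s > 0` are irrelevant. -/
structure IsDSigmaFamily [AddCommGroup R] [LinearOrder R] [TopologicalSpace R] {n : ℕ}
    (X : R → R → Set (Fin n → R)) : Prop where
  definable_family : ∃ 𝒳 : Set (Fin 2 ⊕ Fin n → R), (Set.univ : Set R).Definable L 𝒳 ∧
    ∀ r s : R, 0 < r → 0 < s → X r s = {y | Sum.elim ![r, s] y ∈ 𝒳}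
  isCBD : ∀ r s : R, 0 < r → 0 < s → IsCBD L (X r s)
  increasing : ∀ r r' s : R, 0 < r → r < r' → 0 < s → X r s ⊆ X r' s
  decreasing : ∀ r s s' : R, 0 < r → 0 < s → s < s' → X r s' ⊆ X r s

/-- A `D_Σ`-set: a definable subset of `R ^ n` that is the union of a `D_Σ`-family. -/
def IsDSigma [AddCommGroup R] [LinearOrder R] [TopologicalSpace R] {n : ℕ}
    (X : Set (Fin n → R)) : Prop :=
  (Set.univ : Set R).Definable L X ∧
    ∃ F : R → R → Set (Fin n → R), IsDSigmaFamily L F ∧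
      X = {y | ∃ r s : R, 0 < r ∧ 0 < s ∧ y ∈ F r s}

end OrderedStructures

/-- A finite boolean combination of open sets. (Mathlib's `Topology.IsConstructible` uses
retrocompact open sets only, which is a different notion in spaces like `R ^ n`.) -/
def IsBooleanCombinationOfOpens {α : Type*} [TopologicalSpace α] (X : Set α) : Prop :=
  X ∈ BooleanSubalgebra.closure {U : Set α | IsOpen U}

/-! For a set `A`, let `C = closure (closure A \ A)`. Then `A` is the union of the difference of
closed sets `closure A \ C` and of `A ∩ C`, the points where `A` is not locally closed. If `A` is a
`D_Σ`-set, so is `A ∩ C`, because `C` is closed and definable. Everything rests on a drop in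
dimension: if no projection of `A` to `d + 1` distinct coordinates has interior, then no projection
of `A ∩ C` to `d` distinct coordinates has interior (`DimLT.inter_closure_frontier`). Induction on
this bound finishes the proof: it holds vacuously at `n + 1`, and at `0` the set is empty.

Two tools give the drop. Definable completeness yields a definable form of compactness: projections
of closed bounded definable sets are closed, and interior of a projection survives intersection with
a small box (`exists_cluster`, `isClosed_image_comp`, `exists_box`). The dichotomy for closed
subsets of the line yields that the union of a definable chain of closed discrete sets is closed
discrete, and from this, by induction on the dimension, a Baire property: a `D_Σ`-union of sets
without interior is nowhere dense (`IsTameExpansion.baireProperty`).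

Suppose a projection of `A ∩ C` to `d` coordinates has interior. By Baire, so does that of a single
closed bounded member `K ⊆ A ∩ C`. Over generic base points the fibers of `A` have closed discrete
coordinates, so by compactness points of `K` are isolated in their fibers of `A`; Baire makes the
radius uniform over an open set of base points (`exists_disjoint`). In a small box around a point of
`K`, `A` then coincides with the closed set `K`, which contradicts that the point lies in `C`. -/

set_option linter.unusedSectionVars false

/-! ### Closure properties of definable relations and functions -/

section DefinabilityCalculus

/-- The relation `P` is definable in the `L`-structure `R`, with parameters from `R`. -/
def DefinableRel (L : Language) {R : Type*} [L.Structure R] {α : Type} (P : (α → R) → Prop) :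
    Prop :=
  (Set.univ : Set R).Definable L {v | P v}

/-- The function `f` has a definable graph. -/
def DefinableFun (L : Language) {R : Type*} [L.Structure R] {α : Type} (f : (α → R) → R) : Prop :=
  DefinableRel L fun w : Option α → R => w none = f fun a => w (some a)

variable {L : Language} {R : Type*} [L.Structure R] {α β κ : Type}

namespace DefinableRel

theorem congr {P Q : (α → R) → Prop} (hP : DefinableRel L P) (h : ∀ v, P v ↔ Q v) :
    DefinableRel L Q := by
  have : P = Q := funext fun v => propext (h v)
  exact this ▸ hP

theorem and {P Q : (α → R) → Prop} (hP : DefinableRel L P) (hQ : DefinableRel L Q) :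
    DefinableRel L fun v => P v ∧ Q v :=
  Set.Definable.inter hP hQ

theorem or {P Q : (α → R) → Prop} (hP : DefinableRel L P) (hQ : DefinableRel L Q) :
    DefinableRel L fun v => P v ∨ Q v :=
  Set.Definable.union hP hQ

theorem not {P : (α → R) → Prop} (hP : DefinableRel L P) : DefinableRel L fun v => ¬P v :=
  Set.Definable.compl hP

theorem imp {P Q : (α → R) → Prop} (hP : DefinableRel L P) (hQ : DefinableRel L Q) :
    DefinableRel L fun v => P v → Q v :=
  (hP.not.or hQ).congr fun _ => imp_iff_not_or.symm

theorem const (p : Prop) : DefinableRel L fun _ : α → R => p := by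
  by_cases hp : p
  · exact congr (P := fun _ => True) Set.definable_univ fun _ => (iff_true_left trivial).2 hp
  · exact congr (P := fun _ => False) Set.definable_empty fun _ => (iff_false_left not_false).2 hp

theorem comap {P : (α → R) → Prop} (hP : DefinableRel L P) (f : α → β) :
    DefinableRel L fun w : β → R => P fun a => w (f a) :=
  Set.Definable.preimage_comp f hP

theorem exists_tuple [Finite κ] {P : (α → R) → (κ → R) → Prop}
    (h : DefinableRel L fun w : α ⊕ κ → R => P (fun a => w (.inl a)) fun k => w (.inr k)) :
    DefinableRel L fun v => ∃ y, P v y :=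
  Set.Definable.exists_of_finite h

theorem forall_tuple [Finite κ] {P : (α → R) → (κ → R) → Prop}
    (h : DefinableRel L fun w : α ⊕ κ → R => P (fun a => w (.inl a)) fun k => w (.inr k)) :
    DefinableRel L fun v => ∀ y, P v y :=
  Set.Definable.forall_of_finite h

theorem exists_elem {P : (α → R) → R → Prop}
    (h : DefinableRel L fun w : Option α → R => P (fun a => w (some a)) (w none)) :
    DefinableRel L fun v => ∃ x, P v x := by
  have h' : DefinableRel L fun v : α → R => ∃ y : Fin 1 → R, P v (y 0) :=
    exists_tuple (h.comap fun o : Option α => o.elim (Sum.inr (0 : Fin 1)) Sum.inl)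
  exact h'.congr fun v => ⟨fun ⟨y, hy⟩ => ⟨y 0, hy⟩, fun ⟨x, hx⟩ => ⟨fun _ => x, hx⟩⟩

theorem forall_elem {P : (α → R) → R → Prop}
    (h : DefinableRel L fun w : Option α → R => P (fun a => w (some a)) (w none)) :
    DefinableRel L fun v => ∀ x, P v x :=
  (exists_elem (P := fun v x => ¬P v x) h.not).not.congr fun _ => not_exists_not

theorem forall_finite {ι : Type*} [Finite ι] {P : ι → (α → R) → Prop}
    (h : ∀ i, DefinableRel L (P i)) : DefinableRel L fun v => ∀ i, P i v := by
  have := Set.definable_iInter_of_finite h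
  unfold DefinableRel
  convert this using 1
  ext v
  simp

theorem fun_comp [Finite β] {P : (β → R) → Prop} (hP : DefinableRel L P) {f : (α → R) → β → R}
    (hf : ∀ b, DefinableFun L fun v => f v b) : DefinableRel L fun v => P (f v) := by
  have h : DefinableRel L fun v : α → R => ∃ y : β → R, (∀ b, y b = f v b) ∧ P y :=
    exists_tuple (.and (.forall_finite fun b =>
      (hf b).comap fun o : Option α => o.elim (Sum.inr b) Sum.inl) (hP.comap Sum.inr))
  exact h.congr fun v => ⟨fun ⟨y, hy, h⟩ => (funext hy : y = f v) ▸ h, fun h => ⟨_, fun _ => rfl, h⟩⟩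

theorem mem_set [Finite β] {S : Set (β → R)} (hS : DefinableRel L fun v => v ∈ S)
    {f : (α → R) → β → R} (hf : ∀ b, DefinableFun L fun v => f v b) :
    DefinableRel L fun v => f v ∈ S :=
  fun_comp hS hf

end DefinableRel

namespace DefinableFun

theorem comap {f : (α → R) → R} (hf : DefinableFun L f) (g : α → β) :
    DefinableFun L fun w : β → R => f fun a => w (g a) :=
  DefinableRel.comap hf (Option.map g)

theorem proj (a : α) : DefinableFun L fun v : α → R => v a := by
  refine ⟨(Language.var none).equal (Language.var (some a)), ?_⟩
  ext w
  simp

theorem const (c : R) : DefinableFun L fun _ : α → R => c := by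
  refine ⟨(Language.var none).equal (L.con (⟨c, trivial⟩ : (Set.univ : Set R))).term, ?_⟩
  ext w
  simp

end DefinableFun

theorem DefinableRel.eq {f g : (α → R) → R} (hf : DefinableFun L f) (hg : DefinableFun L g) :
    DefinableRel L fun v => f v = g v := by
  have h : DefinableRel L fun v : Fin 2 → R => v 0 = v 1 := by
    refine ⟨(Language.var 0).equal (Language.var 1), ?_⟩
    ext w
    simp
  exact h.fun_comp (f := fun v => ![f v, g v]) (by simp [Fin.forall_fin_two, hf, hg])

theorem DefinableFun.of_rel {f : (α → R) → R} {P : (α → R) → R → Prop}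
    (hP : DefinableRel L fun w : Option α → R => P (fun a => w (some a)) (w none))
    (h : ∀ v x, P v x ↔ x = f v) : DefinableFun L f :=
  hP.congr fun _ => h _ _

namespace IsOrderedGroupExpansion

variable [AddCommGroup R] [LinearOrder R] (h : IsOrderedGroupExpansion L (R := R))
  {f g : (α → R) → R}
include h

theorem lt (hf : DefinableFun L f) (hg : DefinableFun L g) : DefinableRel L fun v => f v < g v :=
  DefinableRel.fun_comp (P := fun v : Fin 2 → R => v 0 < v 1) h.definable_lt
    (f := fun v => ![f v, g v]) (by simp [Fin.forall_fin_two, hf, hg])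

theorem le (hf : DefinableFun L f) (hg : DefinableFun L g) : DefinableRel L fun v => f v ≤ g v :=
  (h.lt hg hf).not.congr fun _ => not_lt

theorem add (hf : DefinableFun L f) (hg : DefinableFun L g) :
    DefinableFun L fun v => f v + g v :=
  (DefinableRel.fun_comp (P := fun v : Fin 3 → R => v 0 + v 1 = v 2) h.definable_add
    (f := fun w : Option α → R => ![f fun a => w (some a), g fun a => w (some a), w none])
    (by
      simp only [Fin.forall_fin_succ]
      exact ⟨hf.comap _, hg.comap _, DefinableFun.proj _, fun i => i.elim0⟩)).congr
    fun _ => eq_comm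

theorem neg (hf : DefinableFun L f) : DefinableFun L fun v => -f v :=
  .of_rel (P := fun v x => f v + x = 0)
    (.eq (h.add (hf.comap _) (.proj _)) (.const _)) fun _ _ => by
      rw [eq_comm (b := -_), neg_eq_iff_add_eq_zero]

theorem sub (hf : DefinableFun L f) (hg : DefinableFun L g) :
    DefinableFun L fun v => f v - g v := by
  simpa only [sub_eq_add_neg] using h.add hf (h.neg hg)

theorem abs (hf : DefinableFun L f) : DefinableFun L fun v => |f v| :=
  .of_rel (P := fun v x => f v ≤ x ∧ -f v ≤ x ∧ (x = f v ∨ x = -f v))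
    (.and (h.le (hf.comap _) (.proj _)) <| .and (h.le (h.neg (hf.comap _)) (.proj _)) <|
      .or (.eq (.proj _) (hf.comap _)) (.eq (.proj _) (h.neg (hf.comap _)))) fun v x => by
      constructor
      · rintro ⟨h1, h2, rfl | rfl⟩
        · exact (max_eq_left h2).symm
        · exact (max_eq_right h1).symm
      · rintro rfl
        exact ⟨le_max_left _ _, le_max_right _ _, max_choice _ _⟩

end IsOrderedGroupExpansion

end DefinabilityCalculus

/-! ### Cubes as a definable basis of the topology -/

section Cubes

variable {R : Type*} [AddCommGroup R] [LinearOrder R] {ι κ : Type*}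

/-- The open cube of radius `ε` centred at `y`. -/
def cube (y : ι → R) (ε : R) : Set (ι → R) := {x | ∀ i, |x i - y i| < ε}

theorem cube_mono {y : ι → R} {ε δ : R} (h : ε ≤ δ) : cube y ε ⊆ cube y δ :=
  fun _ hx i => (hx i).trans_le h

variable [IsOrderedAddMonoid R]

theorem mem_cube_self {y : ι → R} {ε : R} (hε : 0 < ε) : y ∈ cube y ε := fun i => by simpa

theorem exists_pos_add_self_lt [DenselyOrdered R] {ε : R} (hε : 0 < ε) : ∃ δ, 0 < δ ∧ δ + δ < ε := by
  obtain ⟨a, ha, ha'⟩ := exists_between hε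
  obtain ⟨b, hb, hb'⟩ := exists_between (lt_min ha (sub_pos.2 ha'))
  refine ⟨b, hb, ?_⟩
  have h1 := hb'.trans_le (min_le_left _ _)
  have h2 := hb'.trans_le (min_le_right _ _)
  calc b + b < a + (ε - a) := add_lt_add h1 h2
    _ = ε := by abel

variable [TopologicalSpace R] [OrderTopology R]

theorem isOpen_cube [Finite ι] (y : ι → R) (ε : R) : IsOpen (cube y ε) := by
  have : cube y ε = ⋂ i, {x | |x i - y i| < ε} := by ext; simp [cube]
  rw [this]
  exact isOpen_iInter_of_finite fun i =>
    isOpen_lt ((continuous_apply i).sub continuous_const).abs continuous_const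

variable [DenselyOrdered R] [Nontrivial R]

theorem exists_cube_subset [Finite ι] {U : Set (ι → R)} (hU : IsOpen U) {y : ι → R} (hy : y ∈ U) :
    ∃ ε, 0 < ε ∧ cube y ε ⊆ U := by
  obtain ⟨u, hu, hsub⟩ := isOpen_pi_iff'.1 hU y hy
  have h1 : ∀ i, ∀ᶠ ε in nhdsWithin (0 : R) (Set.Ioi 0), {x | |x - y i| < ε} ⊆ u i := by
    intro i
    obtain ⟨ε, hε, hsub⟩ :=
      (nhds_basis_abs_sub_lt (y i)).mem_iff.1 ((hu i).1.mem_nhds (hu i).2)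
    filter_upwards [Ioo_mem_nhdsGT hε] with δ hδ x hx
    exact hsub (lt_trans hx hδ.2)
  obtain ⟨ε, hε, hpos⟩ := ((Filter.eventually_all.2 h1).and self_mem_nhdsWithin).exists
  exact ⟨ε, hpos, fun x hx => hsub fun i _ => hε i (hx i)⟩

theorem mem_closure_iff_cube [Finite ι] {X : Set (ι → R)} {y : ι → R} :
    y ∈ closure X ↔ ∀ ε, 0 < ε → ∃ x, x ∈ X ∧ x ∈ cube y ε := by
  rw [mem_closure_iff]
  constructor
  · intro h ε hε
    obtain ⟨x, hx, hx'⟩ := h _ (isOpen_cube y ε) (mem_cube_self hε)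
    exact ⟨x, hx', hx⟩
  · intro h U hU hy
    obtain ⟨ε, hε, hsub⟩ := exists_cube_subset hU hy
    obtain ⟨x, hx, hx'⟩ := h ε hε
    exact ⟨x, hsub hx', hx⟩

theorem mem_interior_iff_cube [Finite ι] {X : Set (ι → R)} {y : ι → R} :
    y ∈ interior X ↔ ∃ ε, 0 < ε ∧ ∀ x, x ∈ cube y ε → x ∈ X := by
  constructor
  · intro h
    obtain ⟨ε, hε, hsub⟩ := exists_cube_subset isOpen_interior h
    exact ⟨ε, hε, fun x hx => interior_subset (hsub hx)⟩
  · rintro ⟨ε, hε, h⟩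
    exact interior_maximal h (isOpen_cube y ε) (mem_cube_self hε)

end Cubes

/-! ### Definable families, their closures and interiors -/

section DefinableFamilies

variable {L : Language} {R : Type*} [L.Structure R] {α β ι κ : Type}

/-- The family of the sets `S v` is definable, that is, `{(v, y) | y ∈ S v}` is a definable set. -/
def DefinableFamily (L : Language) {R : Type*} [L.Structure R] {α ι : Type}
    (S : (α → R) → Set (ι → R)) : Prop :=
  DefinableRel L fun w : α ⊕ ι → R => (fun i => w (.inr i)) ∈ S fun a => w (.inl a)

theorem DefinableFamily.mem [Finite α] [Finite ι] {S : (α → R) → Set (ι → R)}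
    (hS : DefinableFamily L S) {g : (β → R) → α → R} (hg : ∀ a, DefinableFun L fun v => g v a)
    {f : (β → R) → ι → R} (hf : ∀ i, DefinableFun L fun v => f v i) :
    DefinableRel L fun v => f v ∈ S (g v) :=
  DefinableRel.fun_comp hS (f := fun v => Sum.elim (g v) (f v)) (by rintro (a | i) <;> simp [*])

theorem DefinableRel.app₂ {P : R → R → Prop}
    (hP : DefinableRel L fun v : Fin 2 → R => P (v 0) (v 1))
    {f g : (α → R) → R} (hf : DefinableFun L f) (hg : DefinableFun L g) :
    DefinableRel L fun v => P (f v) (g v) :=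
  hP.fun_comp (f := fun v => ![f v, g v]) (by simp [Fin.forall_fin_two, hf, hg])

variable [AddCommGroup R] [LinearOrder R]

theorem IsOrderedGroupExpansion.mem_cube (h : IsOrderedGroupExpansion L (R := R)) [Finite ι]
    {x y : (α → R) → ι → R} {ε : (α → R) → R} (hx : ∀ i, DefinableFun L fun v => x v i)
    (hy : ∀ i, DefinableFun L fun v => y v i) (hε : DefinableFun L ε) :
    DefinableRel L fun v => x v ∈ cube (y v) (ε v) :=
  .forall_finite fun i => h.lt (h.abs (h.sub (hx i) (hy i))) hε

variable [IsOrderedAddMonoid R] [TopologicalSpace R] [OrderTopology R] [DenselyOrdered R]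
  [Nontrivial R]

theorem DefinableFamily.closure (h : IsOrderedGroupExpansion L (R := R)) [Finite α] [Finite ι]
    {S : (α → R) → Set (ι → R)} (hS : DefinableFamily L S) :
    DefinableFamily L fun v => closure (S v) := by
  refine DefinableRel.congr ?_ fun w => mem_closure_iff_cube.symm
  apply_rules [DefinableRel.forall_elem, DefinableRel.imp, h.lt, DefinableFun.const,
    DefinableFun.proj, DefinableRel.exists_tuple, DefinableRel.and, hS.mem, h.mem_cube] <;>
  · intros
    apply DefinableFun.proj

theorem DefinableFamily.interior (h : IsOrderedGroupExpansion L (R := R)) [Finite α] [Finite ι]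
    {S : (α → R) → Set (ι → R)} (hS : DefinableFamily L S) :
    DefinableFamily L fun v => interior (S v) := by
  refine DefinableRel.congr ?_ fun w => mem_interior_iff_cube.symm
  apply_rules [DefinableRel.exists_elem, DefinableRel.imp, h.lt, DefinableFun.const,
    DefinableFun.proj, DefinableRel.forall_tuple, DefinableRel.and, hS.mem, h.mem_cube] <;>
  · intros
    apply DefinableFun.proj

end DefinableFamilies

/-! ### Closed discrete subsets of the line and unions of chains -/

section ClosedDiscrete

/-- A definably complete expansion of a densely ordered abelian group in which every
definable closed subset of the line is discrete or contains an interval. -/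
structure IsTameExpansion (L : Language) (R : Type*) [L.Structure R] [AddCommGroup R]
    [LinearOrder R] [TopologicalSpace R] : Prop extends IsOrderedGroupExpansion L (R := R) where
  complete : IsDefinablyComplete L R
  discrete_or_interval : ClosedDiscreteOrInterval L R

/-- A subset of the line without accumulation points. -/
def ClosedDiscrete {R : Type*} [AddCommGroup R] [LinearOrder R] (Y : Set R) : Prop :=
  ∀ x, ∃ ε, 0 < ε ∧ ∀ y ∈ Y, |y - x| < ε → y = x

variable {R : Type*} [AddCommGroup R] [LinearOrder R] [IsOrderedAddMonoid R]

theorem ClosedDiscrete.mono {Y Z : Set R} (hZ : ClosedDiscrete Z) (h : Y ⊆ Z) :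
    ClosedDiscrete Y := fun x =>
  let ⟨ε, hε, H⟩ := hZ x
  ⟨ε, hε, fun y hy => H y (h hy)⟩

theorem ClosedDiscrete.neg {Y : Set R} (hY : ClosedDiscrete Y) :
    ClosedDiscrete {y | -y ∈ Y} := by
  intro x
  obtain ⟨ε, hε, h⟩ := hY (-x)
  refine ⟨ε, hε, fun y hy hyx => neg_injective (h _ hy ?_)⟩
  rwa [neg_sub_neg, abs_sub_comm]

theorem ClosedDiscrete.exists_left {Y : Set R} (hY : ClosedDiscrete Y) (x : R) :
    ∃ u, u < x ∧ ∀ y ∈ Y, u < y → x ≤ y := by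
  obtain ⟨ε, hε, h⟩ := hY x
  refine ⟨x - ε, sub_lt_self _ hε, fun y hy hu => ?_⟩
  by_contra! hlt
  refine hlt.ne (h y hy ?_)
  rw [abs_sub_comm, abs_of_pos (sub_pos.2 hlt)]
  exact sub_lt_comm.1 hu

theorem ClosedDiscrete.of_sides {Y : Set R}
    (hl : ∀ x, ∃ u, u < x ∧ ∀ y ∈ Y, u < y → x ≤ y)
    (hr : ∀ x, ∃ u, x < u ∧ ∀ y ∈ Y, y < u → y ≤ x) : ClosedDiscrete Y := by
  intro x
  obtain ⟨u, hu, h1⟩ := hl x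
  obtain ⟨u', hu', h2⟩ := hr x
  refine ⟨min (x - u) (u' - x), lt_min (sub_pos.2 hu) (sub_pos.2 hu'), fun y hy hyx => ?_⟩
  obtain ⟨h3, h4⟩ := abs_lt.1 hyx
  refine le_antisymm (h2 y hy ?_) (h1 y hy ?_)
  · simpa using h4.trans_le (min_le_right _ _)
  · have := (neg_le_neg (min_le_left (x - u) (u' - x))).trans_lt h3
    simpa using this

variable [TopologicalSpace R] [OrderTopology R]

theorem ClosedDiscrete.exists_open {Y : Set R} (hY : ClosedDiscrete Y) (x : R) :
    ∃ U : Set R, IsOpen U ∧ x ∈ U ∧ ∀ y ∈ Y, y ∈ U → y = x := by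
  obtain ⟨ε, hε, h⟩ := hY x
  exact ⟨{y | |y - x| < ε}, isOpen_lt (continuous_id.sub continuous_const).abs continuous_const,
    by simpa, h⟩

variable [DenselyOrdered R]

theorem ClosedDiscrete.of_isDiscrete [Nontrivial R] {Y : Set R} (hY : IsClosed Y)
    (hd : IsDiscrete Y) : ClosedDiscrete Y := by
  intro x
  suffices h : ∃ U ∈ nhds x, ∀ y ∈ Y, y ∈ U → y = x by
    obtain ⟨U, hU, h⟩ := h
    obtain ⟨ε, hε, hsub⟩ := (nhds_basis_abs_sub_lt x).mem_iff.1 hU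
    exact ⟨ε, hε, fun y hy hyx => h y hy (hsub hyx)⟩
  by_cases hx : x ∈ Y
  · have h := isDiscrete_iff_nhdsWithin.1 hd x hx
    have h' : {x} ∈ nhdsWithin x Y := by rw [h]; exact Filter.mem_pure.2 rfl
    obtain ⟨U, hU, hsub⟩ := mem_nhdsWithin_iff_exists_mem_nhds_inter.1 h'
    exact ⟨U, hU, fun y hy hyU => hsub ⟨hyU, hy⟩⟩
  · exact ⟨Yᶜ, hY.isOpen_compl.mem_nhds hx, fun y hy hy' => absurd hy hy'⟩

variable {L : Language} [L.Structure R]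

namespace IsTameExpansion

variable (H : IsTameExpansion L R)
include H

theorem exists_isLUB {Y : Set R} (hY : DefinableRel L fun v : Fin 1 → R => v 0 ∈ Y)
    (hne : Y.Nonempty) (hb : BddAbove Y) : ∃ a, IsLUB Y a :=
  (H.complete Y hY hne).1 hb

variable [Nontrivial R]

theorem closedDiscrete {Y : Set R} (hY : DefinableRel L fun v : Fin 1 → R => v 0 ∈ Y)
    (hc : IsClosed Y) (h : ∀ a b, a < b → ¬Set.Ioo a b ⊆ Y) : ClosedDiscrete Y :=
  .of_isDiscrete hc <| (H.discrete_or_interval Y hY hc).resolve_right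
    fun ⟨a, b, hab, hsub⟩ => h a b hab hsub

/-- The supremum of the points below `x` exists by definable completeness, and it is attained
because `Y` does not accumulate at it. -/
theorem exists_isGreatest_lt {Y : Set R} (hY : DefinableRel L fun v : Fin 1 → R => v 0 ∈ Y)
    (hcd : ClosedDiscrete Y) {x : R} (hne : ∃ y ∈ Y, y < x) :
    ∃ m, m ∈ Y ∧ m < x ∧ ∀ y ∈ Y, y < x → y ≤ m := by
  obtain ⟨m, hm⟩ := H.exists_isLUB (Y := {y | y ∈ Y ∧ y < x})
    (.and hY (H.lt (.proj _) (.const _))) hne ⟨x, fun y hy => hy.2.le⟩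
  obtain ⟨u, hu, h⟩ := hcd.exists_left m
  obtain ⟨y, hy, huy, hym⟩ := hm.exists_between hu
  obtain rfl : y = m := le_antisymm hym (h y hy.1 huy)
  exact ⟨y, hy.1, hy.2, fun z hz hzx => hm.1 ⟨hz, hzx⟩⟩

/-- If the union accumulated at `x` from the left, the last points before `x` of the individual sets
would do so too. These last points are thin enough for the dichotomy to apply: together with `x`
they form a closed set without intervals, hence without accumulation points. -/
theorem exists_left_of_chain {Y : R → Set R}
    (hY : DefinableRel L fun v : Fin 2 → R => v 1 ∈ Y (v 0))
    (hcd : ∀ i, ClosedDiscrete (Y i)) (hchain : ∀ i j, Y i ⊆ Y j ∨ Y j ⊆ Y i) (x : R) :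
    ∃ u, u < x ∧ ∀ y ∈ {y | ∃ i, y ∈ Y i}, u < y → x ≤ y := by
  by_contra! hacc
  have hmem : ∀ {α : Type} {f g : (α → R) → R}, DefinableFun L f → DefinableFun L g →
      DefinableRel L fun v => g v ∈ Y (f v) := fun hf hg => hY.app₂ (P := fun i y => y ∈ Y i) hf hg
  set P : Set R := {p | ∃ i, p ∈ Y i ∧ p < x ∧ ∀ y, y ∈ Y i → y < x → y ≤ p} with hP
  -- Choose `q` in some `Y i` between `z` and `x`. If the last point `p` of `Y j` lies below `q`,
  -- then `q` is not in `Y j`, so the chain condition forces `Y j ⊆ Y i`. Near `z`, therefore, `P`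
  -- lies in the single closed discrete set `Y i`.
  have hiso : ∀ z < x, ∃ U : Set R, IsOpen U ∧ z ∈ U ∧ ∀ p ∈ P, p ∈ U → p = z := by
    intro z hz
    obtain ⟨q, ⟨i, hqi⟩, hzq, hqx⟩ := hacc z hz
    obtain ⟨U, hU, hzU, h⟩ := (hcd i).exists_open z
    refine ⟨U ∩ Set.Iio q, hU.inter isOpen_Iio, ⟨hzU, hzq⟩, ?_⟩
    rintro p ⟨j, hpj, hpx, hmax⟩ ⟨hpU, hpq⟩
    refine h p ?_ hpU
    refine ((hchain j i).resolve_right fun hij => ?_) hpj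
    exact (hmax q (hij hqi) hqx).not_gt hpq
  have hdef : DefinableRel L fun v : Fin 1 → R => v 0 ∈ P ∪ {x} := by
    refine .or (.exists_elem ?_) (.eq (.proj _) (.const _))
    refine .and (hmem (.proj _) (.proj _)) (.and (H.lt (.proj _) (.const _)) (.forall_elem ?_))
    exact .imp (hmem (.proj _) (.proj _)) (.imp (H.lt (.proj _) (.const _))
      (H.le (.proj _) (.proj _)))
  have hle : ∀ p ∈ P ∪ {x}, p ≤ x := by
    rintro p (⟨i, -, h, -⟩ | rfl)
    exacts [h.le, le_rfl]
  have hclosed : IsClosed (P ∪ {x}) := by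
    rw [← closure_subset_iff_isClosed]
    intro z hz
    rcases lt_trichotomy z x with hzx | rfl | hxz
    · obtain ⟨U, hU, hzU, h⟩ := hiso z hzx
      obtain ⟨p, ⟨hpU, hpx⟩, hp⟩ := mem_closure_iff.1 hz (U ∩ Set.Iio x) (hU.inter isOpen_Iio)
        ⟨hzU, hzx⟩
      have hp' : p ∈ P := hp.resolve_right hpx.ne
      exact h p hp' hpU ▸ hp
    · exact .inr rfl
    · obtain ⟨p, hpx, hp⟩ := mem_closure_iff.1 hz (Set.Ioi x) isOpen_Ioi hxz
      exact absurd (hle p hp) (not_le.2 hpx)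
  have hcdP : ClosedDiscrete (P ∪ {x}) := by
    refine H.closedDiscrete hdef hclosed fun a b hab hsub => ?_
    obtain ⟨c, hac, hcb⟩ := exists_between hab
    have hcx : c ≤ x := hle c (hsub ⟨hac, hcb⟩)
    obtain ⟨z, haz, hzc⟩ := exists_between hac
    have hzx : z < x := hzc.trans_le hcx
    obtain ⟨U, hU, hzU, h⟩ := hiso z hzx
    have hV : U ∩ Set.Ioo a c ∈ nhds z := (hU.inter isOpen_Ioo).mem_nhds ⟨hzU, haz, hzc⟩
    obtain ⟨l, hl, hlsub⟩ := exists_Ioc_subset_of_mem_nhds hV ⟨a, haz⟩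
    obtain ⟨w, hlw, hwz⟩ := exists_between hl
    have hw := hlsub ⟨hlw, hwz.le⟩
    have hwP : w ∈ P := (hsub ⟨hw.2.1, hw.2.2.trans hcb⟩).resolve_right (hwz.trans hzx).ne
    exact hwz.ne (h w hwP hw.1)
  obtain ⟨u, hu, h⟩ := hcdP.exists_left x
  obtain ⟨q, ⟨i, hqi⟩, huq, hqx⟩ := hacc u hu
  obtain ⟨m, hm, hmx, hmax⟩ := H.exists_isGreatest_lt
    (hmem (α := Fin 1) (.const i) (.proj 0)) (hcd i) ⟨q, hqi, hqx⟩
  exact (h m (.inl ⟨i, hm, hmx, hmax⟩) (huq.trans_le (hmax q hqi hqx))).not_gt hmx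

theorem closedDiscrete_of_chain {Y : R → Set R}
    (hY : DefinableRel L fun v : Fin 2 → R => v 1 ∈ Y (v 0))
    (hcd : ∀ i, ClosedDiscrete (Y i)) (hchain : ∀ i j, Y i ⊆ Y j ∨ Y j ⊆ Y i) :
    ClosedDiscrete {y | ∃ i, y ∈ Y i} := by
  refine .of_sides (H.exists_left_of_chain hY hcd hchain) fun x => ?_
  -- Reflection `y ↦ -y` reduces the right side to the left one.
  obtain ⟨u, hu, h⟩ := H.exists_left_of_chain (Y := fun i => {y | -y ∈ Y i})
    (hY.app₂ (P := fun i y => y ∈ Y i) (.proj _) (H.neg (.proj _))) (fun i => (hcd i).neg)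
    (fun i j => (hchain i j).imp (fun h y hy => h hy) fun h y hy => h hy) (-x)
  refine ⟨-u, lt_neg_of_lt_neg hu, ?_⟩
  rintro y ⟨i, hy⟩ hyu
  exact neg_le_neg_iff.1 (h (-y) ⟨i, by simpa using hy⟩ (lt_neg_of_lt_neg hyu))

end IsTameExpansion

end ClosedDiscrete

/-! ### Definable compactness and projections of closed bounded sets -/

section Compactness

variable {L : Language} {R : Type*} [L.Structure R] {α β ι κ : Type}

theorem DefinableRel.eq_tuple [Finite κ] {f g : (α → R) → κ → R}
    (hf : ∀ k, DefinableFun L fun v => f v k) (hg : ∀ k, DefinableFun L fun v => g v k) :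
    DefinableRel L fun v => f v = g v :=
  (DefinableRel.forall_finite fun k => .eq (hf k) (hg k)).congr fun _ => funext_iff.symm

theorem DefinableFamily.mem₁ [Finite ι] {S : R → Set (ι → R)}
    (hS : DefinableFamily L fun p : Fin 1 → R => S (p 0)) {t : (α → R) → R}
    (ht : DefinableFun L t) {f : (α → R) → ι → R} (hf : ∀ i, DefinableFun L fun v => f v i) :
    DefinableRel L fun v => f v ∈ S (t v) :=
  hS.mem (g := fun v _ => t v) (fun _ => ht) hf

theorem DefinableFamily.mem₂ [Finite ι] {S : R → R → Set (ι → R)}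
    (hS : DefinableFamily L fun p : Fin 2 → R => S (p 0) (p 1)) {r s : (α → R) → R}
    (hr : DefinableFun L r) (hs : DefinableFun L s) {f : (α → R) → ι → R}
    (hf : ∀ i, DefinableFun L fun v => f v i) :
    DefinableRel L fun v => f v ∈ S (r v) (s v) :=
  hS.mem (g := fun v => ![r v, s v]) (by simp [Fin.forall_fin_two, hr, hs]) hf

theorem DefinableFamily.image_comp [Finite α] [Finite ι] [Finite κ] {S : (α → R) → Set (ι → R)}
    (hS : DefinableFamily L S) (σ : κ → ι) : DefinableFamily L fun p => (· ∘ σ) '' S p :=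
  .exists_tuple (.and (hS.mem (fun _ => .proj _) fun _ => .proj _)
    (.eq_tuple (fun _ => .proj _) fun _ => .proj _))

variable [AddCommGroup R] [LinearOrder R] [IsOrderedAddMonoid R] [DenselyOrdered R]
  [TopologicalSpace R] [OrderTopology R] [Nontrivial R]

theorem eq_of_forall_abs_sub_lt {x y : R} (h : ∀ ε, 0 < ε → |x - y| < ε) : x = y := by
  by_contra hne
  exact (h _ (abs_pos.2 (sub_ne_zero.2 hne))).false

namespace IsTameExpansion

variable (H : IsTameExpansion L R)
include H

/-- The cluster point is the limit inferior of the family: the supremum of all lower bounds of its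
members. -/
theorem exists_cluster_elem {C : R → Set R}
    (hC : DefinableRel L fun v : Fin 2 → R => v 1 ∈ C (v 0)) {a b : R}
    (hb : ∀ t, C t ⊆ Set.Icc a b) (hne : ∀ t, 0 < t → (C t).Nonempty)
    (hmono : ∀ s t, 0 < s → s ≤ t → C s ⊆ C t) :
    ∃ y, ∀ t ε, 0 < t → 0 < ε → ∃ c ∈ C t, |c - y| < ε := by
  obtain ⟨t₀, ht₀⟩ := exists_gt (0 : R)
  obtain ⟨y, hy⟩ := H.exists_isLUB (Y := {x | ∃ t, 0 < t ∧ ∀ c, c ∈ C t → x ≤ c})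
    (.exists_elem (.and (H.lt (.const _) (.proj _)) (.forall_elem (.imp
      (hC.app₂ (P := fun t c => c ∈ C t) (.proj _) (.proj _)) (H.le (.proj _) (.proj _))))))
    ⟨a, t₀, ht₀, fun c hc => (hb t₀ hc).1⟩
    ⟨b, by
      rintro x ⟨t, ht, h⟩
      obtain ⟨c, hc⟩ := hne t ht
      exact (h c hc).trans (hb t hc).2⟩
  refine ⟨y, fun t ε ht hε => ?_⟩
  obtain ⟨x, ⟨t₁, ht₁, hx⟩, hyx, -⟩ := hy.exists_between (sub_lt_self y hε)
  obtain ⟨z, hyz, hzy⟩ := exists_between (lt_add_of_pos_right y hε)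
  have hz : ∃ c ∈ C (min t t₁), c < z := by
    by_contra! hcon
    exact (hy.1 ⟨min t t₁, lt_min ht ht₁, hcon⟩).not_gt hyz
  obtain ⟨c, hc, hcz⟩ := hz
  have hc₁ := hx c (hmono _ _ (lt_min ht ht₁) (min_le_right _ _) hc)
  refine ⟨c, hmono _ _ (lt_min ht ht₁) (min_le_left _ _) hc, abs_sub_lt_iff.2 ⟨?_, ?_⟩⟩
  · exact sub_lt_iff_lt_add'.2 (hcz.trans hzy)
  · exact sub_lt_comm.1 (hyx.trans_le hc₁)

/-- A decreasing definable family of bounded nonempty sets has a cluster point. -/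
theorem exists_cluster [Finite ι] {C : R → Set (ι → R)}
    (hC : DefinableFamily L fun p : Fin 1 → R => C (p 0)) {a b : ι → R}
    (hb : ∀ t, C t ⊆ Set.Icc a b) (hne : ∀ t, 0 < t → (C t).Nonempty)
    (hmono : ∀ s t, 0 < s → s ≤ t → C s ⊆ C t) :
    ∃ y, ∀ t ε, 0 < t → 0 < ε → ∃ c, c ∈ C t ∧ c ∈ cube y ε := by
  classical
  have := Fintype.ofFinite ι
  suffices h : ∀ S : Finset ι, ∃ y : ι → R, ∀ t ε, 0 < t → 0 < ε → ∃ c ∈ C t,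
      ∀ i ∈ S, |c i - y i| < ε by
    obtain ⟨y, hy⟩ := h Finset.univ
    refine ⟨y, fun t ε ht hε => ?_⟩
    obtain ⟨c, hc, h⟩ := hy t ε ht hε
    exact ⟨c, hc, fun i => h i (Finset.mem_univ i)⟩
  intro S
  induction S using Finset.induction_on with
  | empty =>
    refine ⟨a, fun t ε ht hε => ?_⟩
    obtain ⟨c, hc⟩ := hne t ht
    exact ⟨c, hc, by simp⟩
  | insert j S hj ih =>
    obtain ⟨y, hy⟩ := ih
    -- The parameter `t` also serves as the tolerance in the coordinates already treated, so one
    -- decreasing family on the line controls both.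
    obtain ⟨z, hz⟩ := H.exists_cluster_elem
      (C := fun t => {x | ∃ c, c ∈ C t ∧ (∀ i, i ∈ S → |c i - y i| < t) ∧ x = c j})
      (a := a j) (b := b j)
      (.exists_tuple (.and (hC.mem₁ (.proj _) fun _ => .proj _) (.and
        (.forall_finite fun i => .imp (.const _)
          (H.lt (H.abs (H.sub (.proj _) (.const _))) (.proj _)))
        (.eq (.proj _) (.proj _)))))
      (by
        rintro t _ ⟨c, hc, -, rfl⟩
        exact ⟨(hb t hc).1 j, (hb t hc).2 j⟩)
      (by
        intro t ht
        obtain ⟨c, hc, h⟩ := hy t t ht ht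
        exact ⟨c j, c, hc, h, rfl⟩)
      (by
        rintro s t hs hst _ ⟨c, hc, h, rfl⟩
        exact ⟨c, hmono s t hs hst hc, fun i hi => (h i hi).trans_le hst, rfl⟩)
    refine ⟨Function.update y j z, fun t ε ht hε => ?_⟩
    obtain ⟨_, ⟨c, hc, hcS, rfl⟩, hcz⟩ := hz (min t ε) ε (lt_min ht hε) hε
    refine ⟨c, hmono _ _ (lt_min ht hε) (min_le_left _ _) hc, fun i hi => ?_⟩
    rcases Finset.mem_insert.1 hi with rfl | hi
    · simpa using hcz
    · have hij : i ≠ j := fun h => hj (h ▸ hi)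
      simpa [hij] using (hcS i hi).trans_le (min_le_right _ _)

/-- For `x` in the closure of the image, the points of `K` projecting into ever smaller cubes around
`x` have a cluster point; it lies in `K` and projects to `x`. -/
theorem isClosed_image_comp [Finite ι] [Finite κ] {K : Set (ι → R)}
    (hK : DefinableRel L fun v => v ∈ K) (hc : IsClosed K) (hb : ∃ a b, K ⊆ Set.Icc a b)
    (σ : κ → ι) : IsClosed ((· ∘ σ) '' K) := by
  obtain ⟨a, b, hb⟩ := hb
  rw [← closure_subset_iff_isClosed]
  intro x hx
  rw [mem_closure_iff_cube] at hx
  obtain ⟨y, hy⟩ := H.exists_cluster (C := fun t => {y | y ∈ K ∧ y ∘ σ ∈ cube x t})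
    (.and (hK.mem_set fun _ => .proj _)
      (H.mem_cube (fun _ => .proj _) (fun _ => .const _) (.proj _)))
    (fun t y hy => hb hy.1)
    (fun t ht => by
      obtain ⟨_, ⟨y, hy, rfl⟩, h⟩ := hx t ht
      exact ⟨y, hy, h⟩)
    (fun s t _ hst y hy => ⟨hy.1, cube_mono hst hy.2⟩)
  obtain ⟨t₀, ht₀⟩ := exists_gt (0 : R)
  refine ⟨y, ?_, funext fun k => eq_of_forall_abs_sub_lt fun ε hε => ?_⟩
  · rw [← hc.closure_eq, mem_closure_iff_cube]
    intro ε hε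
    obtain ⟨c, hc, h⟩ := hy t₀ ε ht₀ hε
    exact ⟨c, hc.1, h⟩
  · obtain ⟨δ, hδ, hδε⟩ := exists_pos_add_self_lt hε
    obtain ⟨c, hc, h⟩ := hy δ δ hδ hδ
    calc |y (σ k) - x k| ≤ |y (σ k) - c (σ k)| + |c (σ k) - x k| := abs_sub_le _ _ _
      _ < δ + δ := add_lt_add (abs_sub_comm (c (σ k)) _ ▸ h (σ k)) (hc.2 k)
      _ < ε := hδε

/-- Let `T` be the supremum of the heights `c` for which the part of `K` with `y j ≤ c` has a
projection without interior. Just above `T` the projection has interior; removing the closed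
projection of the part below some `c > T - t` cannot exhaust it. What remains is open and comes from
the slab. -/
theorem exists_slab [Finite ι] [Finite κ] {K : Set (ι → R)}
    (hK : DefinableRel L fun v => v ∈ K) (hc : IsClosed K) (hb : ∃ a b, K ⊆ Set.Icc a b)
    (σ : κ → ι) (hint : (interior ((· ∘ σ) '' K)).Nonempty) (j : ι) {t : R} (ht : 0 < t) :
    ∃ T, (interior ((· ∘ σ) '' (K ∩ {y | |y j - T| ≤ t}))).Nonempty := by
  obtain ⟨a, b, hb⟩ := hb
  have hdef : DefinableFamily L fun p : Fin 1 → R => K ∩ {y | y j ≤ p 0} :=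
    .and (hK.mem_set fun _ => .proj _) (H.le (.proj _) (.proj _))
  have hdef' := (hdef.image_comp σ).interior H.toIsOrderedGroupExpansion
  have hemp : ∀ {c x : R}, c ≤ x →
      (∀ y, y ∉ interior ((· ∘ σ) '' (K ∩ {y | y j ≤ x}))) →
      ∀ y, y ∉ interior ((· ∘ σ) '' (K ∩ {y | y j ≤ c})) := fun hcx h y hy => h y <|
    interior_mono (Set.image_mono (Set.inter_subset_inter_right K fun _ hz => le_trans hz hcx)) hy
  obtain ⟨T, hT⟩ := H.exists_isLUB
    (Y := {c | ∀ y, y ∉ interior ((· ∘ σ) '' (K ∩ {y | y j ≤ c}))})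
    (.forall_tuple (.not
      (hdef'.mem₁ (S := fun c => interior ((· ∘ σ) '' (K ∩ {y | y j ≤ c})))
        (.proj _) fun _ => .proj _)))
    (by
      obtain ⟨c, hc⟩ := exists_lt (a j)
      refine ⟨c, fun y hy => ?_⟩
      obtain ⟨z, ⟨hz, hzc⟩, -⟩ := interior_subset hy
      exact (lt_of_le_of_lt hzc hc).not_ge ((hb hz).1 j))
    ⟨b j, fun c hc => by
      by_contra! hlt
      obtain ⟨y, hy⟩ := hint
      have hsub : K ⊆ K ∩ {y | y j ≤ c} := fun z hz => ⟨hz, ((hb hz).2 j).trans hlt.le⟩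
      exact hc y (interior_mono (Set.image_mono hsub) hy)⟩
  refine ⟨T, ?_⟩
  obtain ⟨c, hcE, hTc, hcT⟩ := hT.exists_between (sub_lt_self T ht)
  have hnot : T + t ∉ {c | ∀ y, y ∉ interior ((· ∘ σ) '' (K ∩ {y | y j ≤ c}))} := fun h =>
    (hT.1 h).not_gt (lt_add_of_pos_right T ht)
  have hnot' : ∃ y, y ∈ interior ((· ∘ σ) '' (K ∩ {y | y j ≤ T + t})) := by
    by_contra! h
    exact hnot h
  have hclosed : IsClosed ((· ∘ σ) '' (K ∩ {y | y j ≤ c})) :=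
    H.isClosed_image_comp
      (.and hK (H.le (.proj _) (.const _)))
      (hc.inter (isClosed_le (continuous_apply j) continuous_const))
      ⟨a, b, Set.inter_subset_left.trans hb⟩ σ
  have hU : (interior ((· ∘ σ) '' (K ∩ {y | y j ≤ T + t})) \
      ((· ∘ σ) '' (K ∩ {y | y j ≤ c}))).Nonempty := by
    obtain ⟨y, hy⟩ := hnot'
    by_contra hcon
    rw [Set.not_nonempty_iff_eq_empty, Set.sdiff_eq_empty] at hcon
    exact hcE y (interior_maximal hcon isOpen_interior hy)
  refine hU.mono (interior_maximal ?_ (isOpen_interior.sdiff hclosed))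
  rintro x ⟨hx, hxc⟩
  obtain ⟨y, ⟨hyK, hyT⟩, rfl⟩ := interior_subset hx
  refine ⟨y, ⟨hyK, abs_sub_le_iff.2 ⟨sub_le_iff_le_add'.2 hyT, ?_⟩⟩, rfl⟩
  have hcy : c < y j := by
    by_contra! hle
    exact hxc ⟨y, ⟨hyK, hle⟩, rfl⟩
  exact sub_le_comm.1 (hTc.trans hcy).le

/-- If a projection of a closed bounded definable set has interior, so has the
projection of its intersection with some small box. -/
theorem exists_box [Finite ι] [Finite κ] {K : Set (ι → R)}
    (hK : DefinableRel L fun v => v ∈ K) (hc : IsClosed K) (hb : ∃ a b, K ⊆ Set.Icc a b)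
    (σ : κ → ι) (hint : (interior ((· ∘ σ) '' K)).Nonempty) {t : R} (ht : 0 < t) :
    ∃ T : ι → R, (interior ((· ∘ σ) '' (K ∩ {y | ∀ i, |y i - T i| ≤ t}))).Nonempty := by
  classical
  have := Fintype.ofFinite ι
  suffices h : ∀ S : Finset ι, ∃ T : ι → R,
      (interior ((· ∘ σ) '' (K ∩ {y | ∀ i, i ∈ S → |y i - T i| ≤ t}))).Nonempty by
    simpa using h Finset.univ
  intro S
  induction S using Finset.induction_on with
  | empty => simpa using hint
  | insert j S hj ih =>
    obtain ⟨T, hT⟩ := ih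
    obtain ⟨z, hz⟩ := H.exists_slab (K := K ∩ {y | ∀ i, i ∈ S → |y i - T i| ≤ t})
      (.and hK (.forall_finite fun i => .imp (.const _)
        (H.le (H.abs (H.sub (.proj _) (.const _))) (.const _))))
      (hc.inter (by
        simp only [Set.ofPred_forall]
        exact isClosed_iInter fun i => isClosed_iInter fun _ =>
          isClosed_le ((continuous_apply i).sub continuous_const).abs continuous_const))
      (let ⟨a, b, hb⟩ := hb; ⟨a, b, Set.inter_subset_left.trans hb⟩) σ hT j ht
    refine ⟨Function.update T j z, hz.mono (interior_mono (Set.image_mono ?_))⟩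
    rintro y ⟨⟨hyK, hyS⟩, hyz⟩
    refine ⟨hyK, fun i hi => ?_⟩
    rcases Finset.mem_insert.1 hi with rfl | hi
    · simpa using hyz
    · have hij : i ≠ j := fun h => hj (h ▸ hi)
      simpa [hij] using hyS i hi

end IsTameExpansion

end Compactness

/-! ### Normalized `D_Σ`-families and their stability -/

section Systems

/-- A `D_Σ`-family in `R ^ ι`, normalized so that its members with a nonpositive second
index are empty. -/
structure IsDSigmaSystem (L : Language) {R : Type*} [L.Structure R] [AddCommGroup R]
    [LinearOrder R] [TopologicalSpace R] {ι : Type} (F : R → R → Set (ι → R)) : Prop where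
  definable : DefinableFamily L fun p : Fin 2 → R => F (p 0) (p 1)
  isClosed : ∀ r s, IsClosed (F r s)
  bounded : ∀ r s, ∃ a b, F r s ⊆ Set.Icc a b
  pos : ∀ r s y, y ∈ F r s → 0 < s
  mono : ∀ r r' s s', r ≤ r' → 0 < s' → s' ≤ s → F r s ⊆ F r' s'

variable {L : Language} {R : Type*} [L.Structure R] {α β ι κ : Type}
  [AddCommGroup R] [LinearOrder R] [IsOrderedAddMonoid R] [DenselyOrdered R]
  [TopologicalSpace R] [OrderTopology R] [Nontrivial R]

namespace IsDSigmaSystem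

variable {F : R → R → Set (ι → R)} (hF : IsDSigmaSystem L F)
include hF

theorem definable_member [Finite ι] (r s : R) : DefinableRel L fun v => v ∈ F r s :=
  hF.definable.mem₂ (.const _) (.const _) fun _ => .proj _

theorem definable_union [Finite ι] : DefinableRel L fun v => v ∈ {y | ∃ r s, y ∈ F r s} :=
  .exists_elem (.exists_elem (hF.definable.mem₂ (.proj _) (.proj _) fun _ => .proj _))

theorem inter {D : R → R → Set (ι → R)}
    (hD : DefinableFamily L fun p : Fin 2 → R => D (p 0) (p 1)) (hc : ∀ r s, IsClosed (D r s))
    (hmono : ∀ r r' s s', r ≤ r' → 0 < s' → s' ≤ s → D r s ⊆ D r' s') :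
    IsDSigmaSystem L fun r s => F r s ∩ D r s where
  definable := .and hF.definable hD
  isClosed r s := (hF.isClosed r s).inter (hc r s)
  bounded r s := let ⟨a, b, h⟩ := hF.bounded r s; ⟨a, b, Set.inter_subset_left.trans h⟩
  pos r s y hy := hF.pos r s y hy.1
  mono r r' s s' h h' h'' :=
    Set.inter_subset_inter (hF.mono r r' s s' h h' h'') (hmono r r' s s' h h' h'')

theorem inter_const [Finite ι] {C : Set (ι → R)} (hC : DefinableRel L fun v => v ∈ C)
    (hc : IsClosed C) : IsDSigmaSystem L fun r s => F r s ∩ C :=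
  hF.inter (D := fun _ _ => C) (hC.mem_set fun _ => .proj _) (fun _ _ => hc)
    fun _ _ _ _ _ _ _ => subset_rfl

theorem image_comp [Finite ι] [Finite κ] (H : IsTameExpansion L R) (σ : κ → ι) :
    IsDSigmaSystem L fun r s => (· ∘ σ) '' F r s where
  definable := hF.definable.image_comp σ
  isClosed r s := H.isClosed_image_comp (hF.definable_member r s) (hF.isClosed r s)
    (hF.bounded r s) σ
  bounded r s := by
    obtain ⟨a, b, h⟩ := hF.bounded r s
    refine ⟨a ∘ σ, b ∘ σ, ?_⟩
    rintro _ ⟨y, hy, rfl⟩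
    exact ⟨fun k => (h hy).1 (σ k), fun k => (h hy).2 (σ k)⟩
  pos r s := by
    rintro _ ⟨y, hy, rfl⟩
    exact hF.pos r s y hy
  mono r r' s s' h h' h'' := Set.image_mono (hF.mono r r' s s' h h' h'')

end IsDSigmaSystem

theorem union_image_comp {F : R → R → Set (ι → R)} (σ : κ → ι) :
    {b | ∃ r s, b ∈ (· ∘ σ) '' F r s} = (· ∘ σ) '' {y | ∃ r s, y ∈ F r s} := by
  ext b
  constructor
  · rintro ⟨r, s, y, hy, rfl⟩
    exact ⟨y, ⟨r, s, hy⟩, rfl⟩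
  · rintro ⟨y, ⟨r, s, hy⟩, rfl⟩
    exact ⟨r, s, y, hy, rfl⟩

/-- The two-parameter union is taken in two stages, each a chain: over `r` for fixed `s`, then over
`s`. -/
theorem IsTameExpansion.closedDiscrete_of_system (H : IsTameExpansion L R) {Y : R → R → Set R}
    (hY : DefinableRel L fun v : Fin 3 → R => v 2 ∈ Y (v 0) (v 1))
    (hpos : ∀ r s y, y ∈ Y r s → 0 < s)
    (hmono : ∀ r r' s s', r ≤ r' → 0 < s' → s' ≤ s → Y r s ⊆ Y r' s')
    (hcd : ∀ r s, ClosedDiscrete (Y r s)) : ClosedDiscrete {y | ∃ s r, y ∈ Y r s} := by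
  have hmem : ∀ {β : Type} {f g h : (β → R) → R}, DefinableFun L f → DefinableFun L g →
      DefinableFun L h → DefinableRel L fun v => h v ∈ Y (f v) (g v) := fun {β f g h} hf hg hh =>
    hY.fun_comp (f := fun v => ![f v, g v, h v]) (by
      simp only [Fin.forall_fin_succ]
      exact ⟨hf, hg, hh, fun i => i.elim0⟩)
  refine H.closedDiscrete_of_chain (Y := fun s => {y | ∃ r, y ∈ Y r s})
    (.exists_elem (hmem (.proj _) (.proj _) (.proj _))) (fun s => ?_) fun s s' => ?_
  · refine H.closedDiscrete_of_chain (Y := fun r => Y r s)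
      (hmem (.proj _) (.const _) (.proj _)) (fun r => hcd r s) fun r r' => ?_
    rcases le_or_gt s 0 with hs | hs
    · exact .inl fun y hy => absurd (hpos r s y hy) hs.not_gt
    · exact (le_total r r').imp (fun h => hmono _ _ _ _ h hs le_rfl)
        fun h => hmono _ _ _ _ h hs le_rfl
  · have key : ∀ s s', s ≤ s' → {y | ∃ r, y ∈ Y r s'} ⊆ {y | ∃ r, y ∈ Y r s} ∨
        {y | ∃ r, y ∈ Y r s} ⊆ {y | ∃ r, y ∈ Y r s'} := by
      intro s s' hss'
      rcases le_or_gt s 0 with hs | hs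
      · exact .inr fun y ⟨r, hy⟩ => absurd (hpos r s y hy) hs.not_gt
      · exact .inl fun y ⟨r, hy⟩ => ⟨r, hmono _ _ _ _ le_rfl hs hss' hy⟩
    rcases le_total s s' with h | h
    · exact (key s s' h).symm
    · exact key s' s h

end Systems

/-! ### Closed cubes -/

section ClosedCubes

variable {R : Type*} [AddCommGroup R] [LinearOrder R] {ι : Type}

/-- The closed cube of radius `ε` centred at `y`. -/
def closedCube (y : ι → R) (ε : R) : Set (ι → R) := {x | ∀ i, |x i - y i| ≤ ε}

theorem cube_subset_closedCube (y : ι → R) (ε : R) : cube y ε ⊆ closedCube y ε :=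
  fun _ hx i => (hx i).le

theorem IsOrderedGroupExpansion.closedCube {L : Language} [L.Structure R]
    (h : IsOrderedGroupExpansion L (R := R)) [Finite ι] (y : ι → R) (ε : R) :
    DefinableRel L fun v => v ∈ closedCube y ε :=
  .forall_finite fun _ => h.le (h.abs (h.sub (.proj _) (.const _))) (.const _)

variable [IsOrderedAddMonoid R]

theorem closedCube_subset_Icc (y : ι → R) (ε : R) :
    closedCube y ε ⊆ Set.Icc (fun i => y i - ε) fun i => y i + ε := by
  intro x hx
  exact ⟨fun i => sub_le_comm.1 (abs_sub_le_iff.1 (hx i)).2,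
    fun i => sub_le_iff_le_add'.1 (abs_sub_le_iff.1 (hx i)).1⟩

variable [TopologicalSpace R] [OrderTopology R]

theorem isClosed_closedCube (y : ι → R) (ε : R) : IsClosed (closedCube y ε) := by
  have : closedCube y ε = ⋂ i, {x | |x i - y i| ≤ ε} := by ext; simp [closedCube]
  rw [this]
  exact isClosed_iInter fun i =>
    isClosed_le ((continuous_apply i).sub continuous_const).abs continuous_const

theorem exists_closedCube_subset [DenselyOrdered R] [Nontrivial R] [Finite ι] {U : Set (ι → R)}
    (hU : IsOpen U) {y : ι → R} (hy : y ∈ U) : ∃ ε, 0 < ε ∧ closedCube y ε ⊆ U := by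
  obtain ⟨ε, hε, hsub⟩ := exists_cube_subset hU hy
  obtain ⟨δ, hδ, hδε⟩ := exists_between hε
  exact ⟨δ, hδ, fun x hx => hsub fun i => (hx i).trans_lt hδε⟩

end ClosedCubes

/-! ### The Baire property for `D_Σ`-families -/

section Baire

variable {L : Language} {R : Type*} [L.Structure R]
  [AddCommGroup R] [LinearOrder R] [TopologicalSpace R]

/-- In `R ^ d`, the union of a `D_Σ`-family of sets without interior is nowhere dense. -/
def BaireProperty (L : Language) (R : Type*) [L.Structure R]
    [AddCommGroup R] [LinearOrder R] [TopologicalSpace R] (d : ℕ) : Prop :=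
  ∀ F : R → R → Set (Fin d → R), IsDSigmaSystem L F → (∀ r s, interior (F r s) = ∅) →
    interior (closure {y | ∃ r s, y ∈ F r s}) = ∅

variable [IsOrderedAddMonoid R] [DenselyOrdered R] [OrderTopology R] [Nontrivial R] {d : ℕ}

namespace BaireProperty

variable (hB : BaireProperty L R d) (H : IsTameExpansion L R)
include hB H

/-- This is the local contrapositive of the Baire property, obtained by cutting the family down to a
closed cube inside `U`. -/
theorem exists_member_interior {F : R → R → Set (Fin d → R)} (hF : IsDSigmaSystem L F)
    {U : Set (Fin d → R)} (hU : IsOpen U) (hne : U.Nonempty)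
    (hsub : U ⊆ closure {y | ∃ r s, y ∈ F r s}) : ∃ r s, (interior (F r s) ∩ U).Nonempty := by
  obtain ⟨y, hy⟩ := hne
  obtain ⟨ε, hε, hεU⟩ := exists_closedCube_subset hU hy
  by_contra! hcon
  have hF' := hF.inter_const (H.closedCube y ε) (isClosed_closedCube y ε)
  have h := hB _ hF' fun r s => by
    rw [← Set.subset_empty_iff, ← hcon r s]
    exact fun x hx => ⟨interior_mono Set.inter_subset_left hx, hεU (interior_subset hx).2⟩
  refine (h ▸ Set.notMem_empty y : y ∉ _) (interior_maximal ?_ (isOpen_cube y ε)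
    (mem_cube_self hε))
  intro x hx
  rw [mem_closure_iff]
  intro V hV hxV
  obtain ⟨z, ⟨hzV, hz⟩, r, s, hzF⟩ := mem_closure_iff.1
    (hsub (hεU (cube_subset_closedCube y ε hx))) _ (hV.inter (isOpen_cube y ε)) ⟨hxV, hx⟩
  exact ⟨z, hzV, r, s, hzF, cube_subset_closedCube y ε hz⟩

/-- A decreasing definable family of `D_Σ`-sets with empty intersection over a nonempty open set
has a member that is not dense in that set. -/
theorem exists_disjoint {G : R → Set (Fin d → R)}
    (hG : DefinableFamily L fun p : Fin 1 → R => G (p 0))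
    (hsys : ∀ t, 0 < t → ∃ F, IsDSigmaSystem L F ∧ G t = {y | ∃ r s, y ∈ F r s})
    (hmono : ∀ s t, 0 < s → s ≤ t → G s ⊆ G t)
    {B : Set (Fin d → R)} (hBo : IsOpen B) (hne : B.Nonempty)
    (hout : ∀ b ∈ B, ∃ t, 0 < t ∧ b ∉ G t) :
    ∃ t V, 0 < t ∧ IsOpen V ∧ V.Nonempty ∧ V ⊆ B ∧ ∀ b ∈ V, b ∉ G t := by
  by_contra! hcon
  obtain ⟨y, hy⟩ := hne
  obtain ⟨ε, hε, hεB⟩ := exists_closedCube_subset hBo hy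
  have hGi := hG.interior H.toIsOrderedGroupExpansion
  -- If every `G s` is dense in `B`, then the closed sets `closedCube y ε \ interior (G s)` have no
  -- interior: `G s` is dense in any such interior, so by Baire one of its own members has interior
  -- there. Yet these sets cover the cube, since each of its points is outside some `G t`.
  have hsysN : IsDSigmaSystem L
      fun _ s : R => {x | 0 < s ∧ x ∈ closedCube y ε ∧ x ∉ interior (G s)} :=
    { definable := .and (H.lt (.const _) (.proj _)) (.and
        ((H.closedCube y ε).mem_set fun _ => .proj _)
        (.not (hGi.mem₁ (S := fun s => interior (G s)) (.proj _) fun _ => .proj _)))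
      isClosed := fun _ s => by
        by_cases hs : 0 < s
        · simp only [hs, true_and]
          exact (isClosed_closedCube y ε).inter isOpen_interior.isClosed_compl
        · simp [hs]
      bounded := fun _ s => ⟨_, _, fun x hx => closedCube_subset_Icc y ε hx.2.1⟩
      pos := fun _ s x hx => hx.1
      mono := fun _ _ s s' _ hs' hss' x hx =>
        ⟨hs', hx.2.1, fun h => hx.2.2 (interior_mono (hmono _ _ hs' hss') h)⟩ }
  have h := hB _ hsysN fun _ s => by
    rw [← Set.not_nonempty_iff_eq_empty]
    intro hW
    have hs : 0 < s := by
      obtain ⟨x, hx⟩ := hW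
      exact (interior_subset hx).1
    obtain ⟨F, hF, hGF⟩ := hsys s hs
    obtain ⟨r, s', x, hxF, hxW⟩ := hB.exists_member_interior H hF isOpen_interior hW fun x hx => by
      rw [← hGF, mem_closure_iff]
      intro V hV hxV
      obtain ⟨z, hz, hzG⟩ := hcon s _ hs (hV.inter isOpen_interior) ⟨x, hxV, hx⟩
        fun z hz => hεB (interior_subset hz.2).2.1
      exact ⟨z, hz.1, hzG⟩
    refine (interior_subset hxW).2.2 (interior_mono ?_ hxF)
    rw [hGF]
    exact fun z hz => ⟨r, s', hz⟩
  refine (h ▸ Set.notMem_empty y : y ∉ _) (interior_maximal ?_ (isOpen_cube y ε)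
    (mem_cube_self hε))
  intro x hx
  have hxC := cube_subset_closedCube y ε hx
  obtain ⟨t, ht, hxt⟩ := hout x (hεB hxC)
  exact subset_closure ⟨t, t, ht, hxC, fun h => hxt (interior_subset h)⟩

end BaireProperty

theorem DefinableFun.snoc {α : Type} {f : (α → R) → Fin d → R} {g : (α → R) → R}
    (hf : ∀ i, DefinableFun L fun v => f v i) (hg : DefinableFun L g) (i : Fin (d + 1)) :
    DefinableFun L fun v => (Fin.snoc (f v) (g v) : Fin (d + 1) → R) i := by
  refine Fin.lastCases ?_ (fun j => ?_) i
  · simpa using hg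
  · simpa using hf j

/-- The points of `F r s` at which an interval of length `s` in the direction of the last
coordinate starts that is contained in `F r s`. -/
theorem IsDSigmaSystem.intervals (H : IsTameExpansion L R) {F : R → R → Set (Fin (d + 1) → R)}
    (hF : IsDSigmaSystem L F) :
    IsDSigmaSystem L fun r s => {y : Fin (d + 1) → R | 0 < s ∧ ∀ u, 0 ≤ u → u ≤ s →
      (Fin.snoc (y ∘ Fin.castSucc) (y (Fin.last d) + u) : Fin (d + 1) → R) ∈ F r s} where
  definable := .and (H.lt (.const _) (.proj _)) (.forall_elem (.imp (H.le (.const _) (.proj _))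
    (.imp (H.le (.proj _) (.proj _)) (hF.definable.mem₂ (.proj _) (.proj _)
      (DefinableFun.snoc (fun _ => .proj _) (H.add (.proj _) (.proj _)))))))
  isClosed r s := by
    by_cases hs : 0 < s
    · simp only [hs, true_and, Set.ofPred_forall]
      refine isClosed_iInter fun u => isClosed_iInter fun _ => isClosed_iInter fun _ =>
        (hF.isClosed r s).preimage ?_
      fun_prop
    · simp [hs]
  bounded r s := by
    obtain ⟨a, b, h⟩ := hF.bounded r s
    refine ⟨a, b, fun y hy => h ?_⟩
    have := hy.2 0 le_rfl hy.1.le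
    rw [add_zero] at this
    convert this using 1
    exact (Fin.snoc_init_self y).symm
  pos r s y hy := hy.1
  mono r r' s s' h h' h'' y hy :=
    ⟨h', fun u hu hus => hF.mono r r' s s' h h' h'' (hy.2 u hu (hus.trans h''))⟩

/-- Otherwise `exists_box` confines the starting points to a box of radius `t` with `2t < s` while
their projection keeps interior. All the intervals, having length `s`, then share a common open
interval, and its product with an open base set lies in `F r s`. -/
theorem IsTameExpansion.interior_image_intervals (H : IsTameExpansion L R)
    {F : R → R → Set (Fin (d + 1) → R)}
    (hF : IsDSigmaSystem L F) (hint : ∀ r s, interior (F r s) = ∅) (r s : R) :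
    interior ((· ∘ Fin.castSucc) '' {y : Fin (d + 1) → R | 0 < s ∧ ∀ u, 0 ≤ u → u ≤ s →
      (Fin.snoc (y ∘ Fin.castSucc) (y (Fin.last d) + u) : Fin (d + 1) → R) ∈ F r s}) = ∅ := by
  have hI := hF.intervals H
  rw [← Set.not_nonempty_iff_eq_empty]
  intro hne
  have hs : 0 < s := by
    obtain ⟨x, hx⟩ := hne
    obtain ⟨y, hy, -⟩ := interior_subset hx
    exact hy.1
  obtain ⟨t, ht, hts⟩ := exists_pos_add_self_lt hs
  obtain ⟨T, b, hb⟩ := H.exists_box (hI.definable_member r s) (hI.isClosed r s) (hI.bounded r s)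
    Fin.castSucc hne ht
  set V := interior ((· ∘ Fin.castSucc) '' ({y : Fin (d + 1) → R | 0 < s ∧ ∀ u, 0 ≤ u → u ≤ s →
      (Fin.snoc (y ∘ Fin.castSucc) (y (Fin.last d) + u) : Fin (d + 1) → R) ∈ F r s} ∩
        {y | ∀ i, |y i - T i| ≤ t}))
  set τ := T (Fin.last d)
  have hlt : τ + t < τ - t + s := by
    rw [sub_add_eq_add_sub, lt_sub_iff_add_lt, add_assoc]
    exact add_lt_add_right hts τ
  obtain ⟨z, hz, hz'⟩ := exists_between hlt
  have hO : IsOpen {x : Fin (d + 1) → R | x ∘ Fin.castSucc ∈ V ∧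
      τ + t < x (Fin.last d) ∧ x (Fin.last d) < τ - t + s} := by
    refine (isOpen_interior.preimage (f := fun x : Fin (d + 1) → R => x ∘ Fin.castSucc)
      (by fun_prop)).inter ((isOpen_lt continuous_const (continuous_apply _)).inter
        (isOpen_lt (continuous_apply _) continuous_const))
  refine (hint r s ▸ Set.notMem_empty _ : (Fin.snoc b z : Fin (d + 1) → R) ∉ interior (F r s))
    (interior_maximal ?_ hO ⟨?_, ?_, ?_⟩)
  · rintro x ⟨hxV, h1, h2⟩
    obtain ⟨y, ⟨hy, hyT⟩, hyx⟩ := interior_subset hxV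
    obtain ⟨h3, h4⟩ := abs_sub_le_iff.1 (hyT (Fin.last d))
    have h5 := hy.2 (x (Fin.last d) - y (Fin.last d))
      (sub_nonneg.2 ((sub_le_iff_le_add'.1 h3).trans h1.le))
      (sub_le_iff_le_add.2 ((h2.le.trans (add_le_add_left (sub_le_comm.1 h4) s)).trans_eq
        (add_comm _ _)))
    rw [add_sub_cancel, show y ∘ Fin.castSucc = x ∘ Fin.castSucc from hyx] at h5
    convert h5 using 1
    exact (Fin.snoc_init_self x).symm
  · convert hb using 1
    ext i
    simp
  · simpa using hz
  · simpa using hz'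

/-- The base points over which some member contains a vertical interval form a nowhere dense set.
Elsewhere the fiber of each member is closed without intervals, hence closed discrete, and so is the
union of these fibers. -/
theorem BaireProperty.exists_closedDiscrete_fibers (hB : BaireProperty L R d)
    (H : IsTameExpansion L R) {F : R → R → Set (Fin (d + 1) → R)}
    (hF : IsDSigmaSystem L F) (hint : ∀ r s, interior (F r s) = ∅) {U : Set (Fin d → R)}
    (hU : IsOpen U) (hne : U.Nonempty) :
    ∃ V ⊆ U, IsOpen V ∧ V.Nonempty ∧ ∀ b ∈ V, ClosedDiscrete
      {z | ∃ s r, (Fin.snoc b z : Fin (d + 1) → R) ∈ F r s} := by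
  obtain ⟨Z, hZ, hZmem⟩ : ∃ Z : Set (Fin d → R), interior (closure Z) = ∅ ∧
      (∀ r s (y : Fin (d + 1) → R), (0 < s ∧
      ∀ u, 0 ≤ u → u ≤ s →
        (Fin.snoc (y ∘ Fin.castSucc) (y (Fin.last d) + u) : Fin (d + 1) → R) ∈ F r s) →
      y ∘ Fin.castSucc ∈ Z) :=
    ⟨_, hB _ ((hF.intervals H).image_comp H Fin.castSucc) (H.interior_image_intervals hF hint),
      fun r s y hy => ⟨r, s, y, hy, rfl⟩⟩
  refine ⟨U \ closure Z, Set.sdiff_subset, hU.sdiff isClosed_closure, ?_, fun b hb => ?_⟩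
  · by_contra hcon
    rw [Set.not_nonempty_iff_eq_empty, Set.sdiff_eq_empty] at hcon
    obtain ⟨y, hy⟩ := hne
    exact (hZ ▸ Set.notMem_empty y : y ∉ _) (interior_maximal hcon hU hy)
  have hdef : ∀ {α : Type} {f g h : (α → R) → R}, DefinableFun L f → DefinableFun L g →
      DefinableFun L h →
      DefinableRel L fun v => (Fin.snoc b (h v) : Fin (d + 1) → R) ∈ F (f v) (g v) :=
    fun hf hg hh => hF.definable.mem₂ hf hg (DefinableFun.snoc (fun _ => .const _) hh)
  refine H.closedDiscrete_of_system
    (Y := fun r s => {z | (Fin.snoc b z : Fin (d + 1) → R) ∈ F r s})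
    (hdef (.proj _) (.proj _) (.proj _)) (fun r s z hz => hF.pos _ _ _ hz)
    (fun r r' s s' h h' h'' z hz => hF.mono r r' s s' h h' h'' hz) fun r s => ?_
  refine H.closedDiscrete (hdef (.const _) (.const _) (.proj _))
    ((hF.isClosed r s).preimage (by fun_prop)) fun a c hac hsub => ?_
  obtain ⟨c₀, h0, hc⟩ := exists_between hac
  -- In `intervals` one number is both the index of the member and the length of the interval.
  -- Passing to the smaller index `min s (c₁ - c₀)` enlarges the member and shortens the interval,
  -- so both requirements are met.
  obtain ⟨c₁, h1, h2⟩ := exists_between hc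
  have hs : 0 < s := hF.pos r s _ (hsub ⟨h0, hc⟩)
  have hs' : 0 < min s (c₁ - c₀) := lt_min hs (sub_pos.2 h1)
  have hsnoc : (Fin.snoc b c₀ : Fin (d + 1) → R) ∘ Fin.castSucc = b := Fin.snoc_comp_castSucc
  refine hb.2 (subset_closure (hsnoc ▸ hZmem r (min s (c₁ - c₀)) (Fin.snoc b c₀)
    ⟨hs', fun u hu hus => ?_⟩))
  refine hF.mono r r s _ le_rfl hs' (min_le_left _ _) ?_
  rw [hsnoc, Fin.snoc_last]
  exact hsub ⟨lt_add_of_lt_of_nonneg h0 hu,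
    (le_sub_iff_add_le'.1 (hus.trans (min_le_right _ _))).trans_lt h2⟩

/-- Over generic base points the fibers of the union do not accumulate at the height `x` of the
centre of the cube. By `exists_disjoint` the gap just above `x` has uniform height over some open
`W`, so the union misses an open box on which it was supposed to be dense. -/
theorem BaireProperty.succ (hB : BaireProperty L R d) (H : IsTameExpansion L R) :
    BaireProperty L R (d + 1) := by
  intro F hF hint
  rw [← Set.not_nonempty_iff_eq_empty]
  rintro ⟨y, hy⟩
  obtain ⟨ε, hε, hεA⟩ := exists_cube_subset isOpen_interior hy
  obtain ⟨V, hVU, hVo, hVne, hV⟩ := hB.exists_closedDiscrete_fibers H hF hint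
    (isOpen_cube (y ∘ Fin.castSucc) ε) ⟨_, mem_cube_self hε⟩
  set x := y (Fin.last d)
  -- The bound `x + s ≤ z (Fin.last d)` makes the members closed; as `s` decreases it exhausts the
  -- open condition `x < z (Fin.last d)`.
  have hsys : ∀ t, 0 < t → IsDSigmaSystem L fun r s => (· ∘ Fin.castSucc) ''
      (F r s ∩ {z | x + s ≤ z (Fin.last d) ∧ z (Fin.last d) ≤ x + t}) := fun t ht =>
    (hF.inter (D := fun _ s => {z | x + s ≤ z (Fin.last d) ∧ z (Fin.last d) ≤ x + t})
      (.and (H.le (H.add (.const _) (.proj _)) (.proj _)) (H.le (.proj _) (.const _)))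
      (fun _ s => (isClosed_le continuous_const (continuous_apply _)).inter
        (isClosed_le (continuous_apply _) continuous_const))
      fun r r' s s' _ _ h z hz => ⟨(add_le_add_right h x).trans hz.1, hz.2⟩).image_comp H _
  obtain ⟨t, W, ht, hWo, ⟨b, hb⟩, hWV, hW⟩ := hB.exists_disjoint H
    (G := fun t => (· ∘ Fin.castSucc) '' ({z | ∃ r s, z ∈ F r s} ∩
      {z | x < z (Fin.last d) ∧ z (Fin.last d) ≤ x + t}))
    (DefinableFamily.image_comp (S := fun p : Fin 1 → R => {z | ∃ r s, z ∈ F r s} ∩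
      {z | x < z (Fin.last d) ∧ z (Fin.last d) ≤ x + p 0}) (.and
        (hF.definable_union.mem_set fun _ => .proj _)
        (.and (H.lt (.const _) (.proj _)) (H.le (.proj _) (H.add (.const _) (.proj _))))) _)
    (fun t ht => ⟨_, hsys t ht, by
      rw [union_image_comp]
      congr 1
      ext z
      constructor
      · rintro ⟨⟨r, s, hz⟩, hxz, hzt⟩
        have hs : 0 < min s (z (Fin.last d) - x) := lt_min (hF.pos r s z hz) (sub_pos.2 hxz)
        exact ⟨r, _, hF.mono r r s _ le_rfl hs (min_le_left _ _) hz,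
          le_sub_iff_add_le'.1 (min_le_right _ _), hzt⟩
      · rintro ⟨r, s, hz, hxz, hzt⟩
        exact ⟨⟨r, s, hz⟩, (lt_add_of_pos_right x (hF.pos r s z hz)).trans_le hxz, hzt⟩⟩)
    (fun s t _ hst => Set.image_mono (Set.inter_subset_inter_right _ fun z hz =>
      ⟨hz.1, hz.2.trans (add_le_add_right hst x)⟩))
    hVo hVne (fun b hb => by
      obtain ⟨δ, hδ, h⟩ := hV b hb x
      obtain ⟨t, ht, htδ⟩ := exists_between hδ
      refine ⟨t, ht, ?_⟩
      rintro ⟨z, ⟨⟨r, s, hz⟩, hxz, hzt⟩, rfl⟩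
      refine hxz.ne' (h _ ⟨s, r, ?_⟩ ?_)
      · convert hz using 1
        exact Fin.snoc_init_self z
      · rw [abs_of_pos (sub_pos.2 hxz)]
        exact (sub_le_iff_le_add'.2 hzt).trans_lt htδ)
  obtain ⟨z, hxz, hz⟩ := exists_between (lt_add_of_pos_right x (lt_min ht hε))
  have hO : IsOpen {v : Fin (d + 1) → R | v ∘ Fin.castSucc ∈ W ∧
      x < v (Fin.last d) ∧ v (Fin.last d) < x + min t ε} :=
    (hWo.preimage (f := fun x : Fin (d + 1) → R => x ∘ Fin.castSucc)
      (by fun_prop)).inter ((isOpen_lt continuous_const (continuous_apply _)).inter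
        (isOpen_lt (continuous_apply _) continuous_const))
  have hsnoc : (Fin.snoc b z : Fin (d + 1) → R) ∘ Fin.castSucc = b := by
    ext i
    simp
  have hcl : (Fin.snoc b z : Fin (d + 1) → R) ∈ closure {y | ∃ r s, y ∈ F r s} := by
    refine interior_subset (hεA (Fin.lastCases ?_ fun i => ?_))
    · rw [Fin.snoc_last, abs_of_pos (sub_pos.2 hxz)]
      exact sub_lt_iff_lt_add'.2 (hz.trans_le (add_le_add_right (min_le_right _ _) x))
    · rw [Fin.snoc_castSucc]
      exact hVU (hWV hb) i
  obtain ⟨v, ⟨hvW, hxv, hvt⟩, hv⟩ := mem_closure_iff.1 hcl _ hO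
    ⟨by rwa [hsnoc], by simpa using hxz, by simpa using hz⟩
  exact hW _ hvW ⟨v, ⟨hv, hxv, hvt.le.trans (add_le_add_right (min_le_left _ _) x)⟩, rfl⟩

theorem IsTameExpansion.baireProperty (H : IsTameExpansion L R) (d : ℕ) : BaireProperty L R d := by
  induction d with
  | zero =>
    intro F _ hint
    have h : {y | ∃ r s, y ∈ F r s} = ∅ := by
      rw [Set.eq_empty_iff_forall_notMem]
      rintro y ⟨r, s, hy⟩
      have : F r s = Set.univ := Set.eq_univ_of_forall fun z => Subsingleton.elim y z ▸ hy
      have h := hint r s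
      rw [this, interior_univ] at h
      exact (h ▸ Set.notMem_empty y : y ∉ Set.univ) trivial
    rw [h, closure_empty, interior_empty]
  | succ d ih => exact ih.succ H

end Baire

/-! ### The drop in dimension -/

section SmallDimension

/-- No projection of `X` to `d` different coordinates has interior; for `D_Σ`-sets this says
that the dimension of `X` is less than `d`. -/
def DimLT {R : Type*} [TopologicalSpace R] {n : ℕ} (X : Set (Fin n → R)) (d : ℕ) : Prop :=
  ∀ σ : Fin d → Fin n, Function.Injective σ → interior ((· ∘ σ) '' X) = ∅

variable {L : Language} {R : Type*} [L.Structure R] {α ι : Type}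

theorem DefinableRel.exists_finite [Finite ι] {P : ι → (α → R) → Prop}
    (h : ∀ i, DefinableRel L (P i)) : DefinableRel L fun v => ∃ i, P i v :=
  (DefinableRel.forall_finite fun i => (h i).not).not.congr fun _ => by simp

variable [AddCommGroup R] [LinearOrder R] [IsOrderedAddMonoid R] [DenselyOrdered R]
  [TopologicalSpace R] [OrderTopology R] [Nontrivial R] {n d : ℕ}

theorem closedDiscrete_singleton (a : R) : ClosedDiscrete {a} := by
  intro x
  by_cases h : a = x
  · obtain ⟨ε, hε⟩ := exists_gt (0 : R)
    exact ⟨ε, hε, fun y hy _ => hy.trans h⟩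
  · refine ⟨|a - x|, abs_pos.2 (sub_ne_zero.2 h), ?_⟩
    rintro _ rfl hlt
    exact absurd hlt (lt_irrefl _)

theorem exists_pos_forall_le [Finite ι] {f : ι → R} (hf : ∀ i, 0 < f i) :
    ∃ ε, 0 < ε ∧ ∀ i, ε ≤ f i := by
  cases isEmpty_or_nonempty ι
  · obtain ⟨ε, hε⟩ := exists_gt (0 : R)
    exact ⟨ε, hε, fun i => isEmptyElim i⟩
  · obtain ⟨i, hi⟩ := Finite.exists_min f
    exact ⟨f i, hf i, hi⟩

theorem comp_snoc (y : Fin n → R) (σ : Fin d → Fin n) (j : Fin n) :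
    y ∘ (Fin.snoc σ j : Fin (d + 1) → Fin n) = Fin.snoc (y ∘ σ) (y j) := by
  ext i
  refine Fin.lastCases ?_ (fun k => ?_) i <;> simp

theorem snoc_injective {σ : Fin d → Fin n} (hσ : Function.Injective σ) {j : Fin n}
    (hj : ∀ k, σ k ≠ j) : Function.Injective (Fin.snoc σ j : Fin (d + 1) → Fin n) := by
  intro a b
  refine Fin.lastCases ?_ (fun a => ?_) a <;> refine Fin.lastCases ?_ (fun b => ?_) b
  · simp
  · simpa using fun h => (hj b h.symm).elim
  · simpa using fun h => (hj a h).elim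
  · simpa using fun h => hσ h

variable (H : IsTameExpansion L R) {F : R → R → Set (Fin n → R)} (hF : IsDSigmaSystem L F)
include H hF

/-- Adjoining a new coordinate `j` to `σ` projects the family to `R ^ (d + 1)`, where by the
dimension bound no member has interior; the fiber result of the Baire section then applies. The
coordinates are treated one at a time while the open set shrinks. -/
theorem DimLT.exists_closedDiscrete_fibers (hdim : DimLT {y | ∃ r s, y ∈ F r s} (d + 1))
    {σ : Fin d → Fin n} (hσ : Function.Injective σ) {U : Set (Fin d → R)} (hU : IsOpen U)
    (hne : U.Nonempty) :
    ∃ V ⊆ U, IsOpen V ∧ V.Nonempty ∧ ∀ b ∈ V, ∀ j, ClosedDiscrete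
      {z | ∃ y, (∃ r s, y ∈ F r s) ∧ y ∘ σ = b ∧ y j = z} := by
  suffices h : ∀ S : Finset (Fin n), ∃ V ⊆ U, IsOpen V ∧ V.Nonempty ∧ ∀ b ∈ V, ∀ j ∈ S,
      ClosedDiscrete {z | ∃ y, (∃ r s, y ∈ F r s) ∧ y ∘ σ = b ∧ y j = z} by
    simpa using h Finset.univ
  intro S
  induction S using Finset.induction_on with
  | empty => exact ⟨U, subset_rfl, hU, hne, by simp⟩
  | insert j S hj ih =>
    obtain ⟨V, hVU, hVo, hVne, hV⟩ := ih
    suffices h : ∃ W ⊆ V, IsOpen W ∧ W.Nonempty ∧ ∀ b ∈ W,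
        ClosedDiscrete {z | ∃ y, (∃ r s, y ∈ F r s) ∧ y ∘ σ = b ∧ y j = z} by
      obtain ⟨W, hWV, hWo, hWne, hW⟩ := h
      refine ⟨W, hWV.trans hVU, hWo, hWne, fun b hb i hi => ?_⟩
      rcases Finset.mem_insert.1 hi with rfl | hi
      exacts [hW b hb, hV b (hWV hb) i hi]
    by_cases hjσ : ∃ k, σ k = j
    · obtain ⟨k, rfl⟩ := hjσ
      refine ⟨V, subset_rfl, hVo, hVne, fun b _ => (closedDiscrete_singleton (b k)).mono ?_⟩
      rintro _ ⟨y, -, rfl, rfl⟩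
      rfl
    · rw [not_exists] at hjσ
      obtain ⟨W, hWV, hWo, hWne, hW⟩ := (H.baireProperty d).exists_closedDiscrete_fibers H
        (hF.image_comp H (Fin.snoc σ j : Fin (d + 1) → Fin n)) (fun r s => by
          rw [← Set.subset_empty_iff, ← hdim _ (snoc_injective hσ hjσ)]
          exact interior_mono (Set.image_mono fun y hy => ⟨r, s, hy⟩)) hVo hVne
      refine ⟨W, hWV, hWo, hWne, fun b hb => (hW b hb).mono ?_⟩
      rintro _ ⟨y, ⟨r, s, hy⟩, rfl, rfl⟩
      exact ⟨s, r, y, hy, comp_snoc y σ j⟩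

/-- The pairs of different points of `K` and of the union of `F` which have the same image
under the projection `σ` and are at distance at most `t`. -/
theorem IsDSigmaSystem.closePairs {K : Set (Fin n → R)} (hK : DefinableRel L fun v => v ∈ K)
    (hc : IsClosed K) (hb : ∃ a b, K ⊆ Set.Icc a b) (σ : Fin d → Fin n) (t : R) :
    IsDSigmaSystem L fun r s => {w : Fin n ⊕ Fin n → R | w ∘ Sum.inl ∈ K ∧ w ∘ Sum.inr ∈ F r s ∧
      w ∘ Sum.inl ∘ σ = w ∘ Sum.inr ∘ σ ∧ (∃ i, s ≤ |w (.inl i) - w (.inr i)|) ∧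
      ∀ i, |w (.inl i) - w (.inr i)| ≤ t} where
  definable := .and (hK.mem_set fun _ => .proj _) (.and
    (hF.definable.mem₂ (.proj _) (.proj _) fun _ => .proj _) (.and
      (.eq_tuple (fun _ => .proj _) fun _ => .proj _) (.and
        (.exists_finite fun _ => H.le (.proj _) (H.abs (H.sub (.proj _) (.proj _))))
        (.forall_finite fun _ => H.le (H.abs (H.sub (.proj _) (.proj _))) (.const _)))))
  isClosed r s := by
    have hcoord : ∀ a : Fin n ⊕ Fin n, Continuous fun w : Fin n ⊕ Fin n → R => w a :=
      continuous_apply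
    have habs : ∀ i, Continuous fun w : Fin n ⊕ Fin n → R => |w (.inl i) - w (.inr i)| :=
      fun i => ((hcoord _).sub (hcoord _)).abs
    have hex : IsClosed {w : Fin n ⊕ Fin n → R | ∃ i, s ≤ |w (.inl i) - w (.inr i)|} := by
      simp only [Set.ofPred_exists]
      exact isClosed_iUnion_of_finite fun i => isClosed_le continuous_const (habs i)
    have hall : IsClosed {w : Fin n ⊕ Fin n → R | ∀ i, |w (.inl i) - w (.inr i)| ≤ t} := by
      simp only [Set.ofPred_forall]
      exact isClosed_iInter fun i => isClosed_le (habs i) continuous_const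
    exact (hc.preimage (f := fun w : Fin n ⊕ Fin n → R => w ∘ Sum.inl) (by fun_prop)).inter
      (((hF.isClosed r s).preimage (f := fun w : Fin n ⊕ Fin n → R => w ∘ Sum.inr)
        (by fun_prop)).inter ((isClosed_eq (f := fun w : Fin n ⊕ Fin n → R => w ∘ Sum.inl ∘ σ)
          (g := fun w : Fin n ⊕ Fin n → R => w ∘ Sum.inr ∘ σ) (by fun_prop) (by fun_prop)).inter
          (hex.inter hall)))
  bounded r s := by
    obtain ⟨a, b, hab⟩ := hb
    obtain ⟨a', b', hab'⟩ := hF.bounded r s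
    refine ⟨Sum.elim a a', Sum.elim b b', fun w hw => ⟨?_, ?_⟩⟩
    · rintro (i | i)
      exacts [(hab hw.1).1 i, (hab' hw.2.1).1 i]
    · rintro (i | i)
      exacts [(hab hw.1).2 i, (hab' hw.2.1).2 i]
  pos r s w hw := hF.pos r s _ hw.2.1
  mono r r' s s' h h' h'' w hw := ⟨hw.1, hF.mono r r' s s' h h' h'' hw.2.1, hw.2.2.1,
    hw.2.2.2.1.imp fun _ hi => h''.trans hi, hw.2.2.2.2⟩

/-- If no radius worked, pairs of distinct points at shrinking distance would cluster at some `x`.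
Each coordinate of both points would eventually equal that of `x`, because the coordinate sets of
the fiber do not accumulate. -/
theorem IsTameExpansion.exists_isolating_radius {K : Set (Fin n → R)}
    (hK : DefinableRel L fun v => v ∈ K) (hbd : ∃ a b, K ⊆ Set.Icc a b)
    (hKA : K ⊆ {y | ∃ r s, y ∈ F r s}) (σ : Fin d → Fin n) {b : Fin d → R}
    (hb : ∀ j, ClosedDiscrete {z | ∃ y, (∃ r s, y ∈ F r s) ∧ y ∘ σ = b ∧ y j = z}) :
    ∃ t, 0 < t ∧ ∀ y y', y ∈ K → y ∘ σ = b → y' ∈ {y | ∃ r s, y ∈ F r s} → y' ∘ σ = b →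
      (∀ i, |y i - y' i| ≤ t) → y = y' := by
  by_contra! hcon
  obtain ⟨a, c, hac⟩ := hbd
  obtain ⟨x, hx⟩ := H.exists_cluster (C := fun t => {y | ∃ y', y ∈ K ∧ y ∘ σ = b ∧
      y' ∈ {y | ∃ r s, y ∈ F r s} ∧ y' ∘ σ = b ∧ (∀ i, |y i - y' i| ≤ t) ∧ ¬y = y'})
    (.exists_tuple (.and (hK.mem_set fun _ => .proj _) (.and
      (.eq_tuple (fun _ => .proj _) fun _ => .const _) (.and
        (hF.definable_union.mem_set fun _ => .proj _) (.and
          (.eq_tuple (fun _ => .proj _) fun _ => .const _) (.and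
            (.forall_finite fun _ => H.le (H.abs (H.sub (.proj _) (.proj _))) (.proj _))
            (.not (.eq_tuple (fun _ => .proj _) fun _ => .proj _))))))))
    (fun t y ⟨_, hy, _⟩ => hac hy) hcon
    fun s t _ hst y ⟨y', h1, h2, h3, h4, h5, h6⟩ =>
      ⟨y', h1, h2, h3, h4, fun i => (h5 i).trans hst, h6⟩
  choose ε hε hiso using fun j => hb j (x j)
  obtain ⟨η, hη, hηε⟩ := exists_pos_forall_le hε
  obtain ⟨δ, hδ, hδη⟩ := exists_pos_add_self_lt hη
  obtain ⟨y, ⟨y', hyK, hyb, hy', hyb', hle, hne⟩, hyx⟩ := hx δ δ hδ hδ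
  refine hne (funext fun i => ?_)
  rw [hiso i (y i) ⟨y, hKA hyK, hyb, rfl⟩ ((hyx i).trans_le
      ((le_add_of_nonneg_left hδ.le).trans (hδη.le.trans (hηε i)))),
    hiso i (y' i) ⟨y', hy', hyb', rfl⟩ ?_]
  calc |y' i - x i| ≤ |y' i - y i| + |y i - x i| := abs_sub_le _ _ _
    _ < δ + δ := add_lt_add_of_le_of_lt (abs_sub_comm (y i) _ ▸ hle i) (hyx i)
    _ < η := hδη
    _ ≤ ε i := hηε i

theorem IsDSigmaSystem.inter_const_closure_frontier : IsDSigmaSystem L fun r s =>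
    F r s ∩ closure (closure {y | ∃ r s, y ∈ F r s} \ {y | ∃ r s, y ∈ F r s}) := by
  have hcl : ∀ {S : Set (Fin n → R)}, (DefinableRel L fun v => v ∈ S) →
      DefinableRel L fun v => v ∈ closure S := fun {S} hS =>
    (DefinableFamily.closure (S := fun _ : Fin 0 → R => S) H.toIsOrderedGroupExpansion
      (hS.mem_set fun _ => .proj _)).mem (g := fun _ i => i.elim0) (fun i => i.elim0)
        fun _ => .proj _
  have hdiff : DefinableRel L fun v =>
      v ∈ closure {y | ∃ r s, y ∈ F r s} \ {y | ∃ r s, y ∈ F r s} :=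
    .and (hcl hF.definable_union) hF.definable_union.not
  exact hF.inter_const (hcl hdiff) isClosed_closure

/-- The points at which a `D_Σ`-set is not locally closed form a set of smaller dimension. -/
theorem DimLT.inter_closure_frontier (hdim : DimLT {y | ∃ r s, y ∈ F r s} (d + 1)) :
    DimLT ({y | ∃ r s, y ∈ F r s} ∩
      closure (closure {y | ∃ r s, y ∈ F r s} \ {y | ∃ r s, y ∈ F r s})) d := by
  intro σ hσ
  set A := {y | ∃ r s, y ∈ F r s}
  have hAdef : DefinableRel L fun v => v ∈ A := hF.definable_union
  have hFC := hF.inter_const_closure_frontier H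
  rw [← Set.not_nonempty_iff_eq_empty]
  intro hne
  have hB := H.baireProperty d
  -- Baire replaces the whole set by one closed bounded member.
  obtain ⟨r, s, hint⟩ := hB.exists_member_interior H (hFC.image_comp H σ) isOpen_interior hne (by
    refine interior_subset.trans (subset_trans ?_ subset_closure)
    rintro _ ⟨y, ⟨⟨r, s, hy⟩, hyC⟩, rfl⟩
    exact ⟨r, s, y, ⟨hy, hyC⟩, rfl⟩)
  set K := F r s ∩ closure (closure A \ A)
  have hKdef := hFC.definable_member r s
  have hKc := hFC.isClosed r s
  have hKb := hFC.bounded r s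
  have hKA : K ⊆ A := fun y hy => ⟨r, s, hy.1⟩
  obtain ⟨V, hVK, hVo, hVne, hV⟩ := hdim.exists_closedDiscrete_fibers H hF hσ isOpen_interior
    hint.left
  -- The `t`-th set consists of the base points where radius `t` fails to isolate `K` in the fiber
  -- of `A`. Each base point in `V` leaves these sets for small `t`, so one `t` works on an open
  -- `W`.
  obtain ⟨t, W, ht, hWo, ⟨b, hb⟩, hWV, hW⟩ := hB.exists_disjoint H
    (G := fun t => (· ∘ Sum.inl ∘ σ) '' {w : Fin n ⊕ Fin n → R | w ∘ Sum.inl ∈ K ∧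
      w ∘ Sum.inr ∈ A ∧ w ∘ Sum.inl ∘ σ = w ∘ Sum.inr ∘ σ ∧ ¬w ∘ Sum.inl = w ∘ Sum.inr ∧
      ∀ i, |w (.inl i) - w (.inr i)| ≤ t})
    (DefinableFamily.image_comp (S := fun p : Fin 1 → R =>
      {w : Fin n ⊕ Fin n → R | w ∘ Sum.inl ∈ K ∧
      w ∘ Sum.inr ∈ A ∧ w ∘ Sum.inl ∘ σ = w ∘ Sum.inr ∘ σ ∧ ¬w ∘ Sum.inl = w ∘ Sum.inr ∧
      ∀ i, |w (.inl i) - w (.inr i)| ≤ p 0}) (.and (hKdef.mem_set fun _ => .proj _) (.and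
        (hAdef.mem_set fun _ => .proj _) (.and (.eq_tuple (fun _ => .proj _) fun _ => .proj _)
          (.and (.not (.eq_tuple (fun _ => .proj _) fun _ => .proj _)) (.forall_finite fun _ =>
            H.le (H.abs (H.sub (.proj _) (.proj _))) (.proj _)))))) _)
    (fun t ht => ⟨_, (hF.closePairs H hKdef hKc hKb σ t).image_comp H (Sum.inl ∘ σ), by
      rw [union_image_comp]
      congr 1
      ext w
      constructor
      · rintro ⟨h1, ⟨r', s', h2⟩, h3, h4, h5⟩
        obtain ⟨i, hi⟩ := Function.ne_iff.1 h4
        have hs : 0 < min s' |w (.inl i) - w (.inr i)| :=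
          lt_min (hF.pos _ _ _ h2) (abs_pos.2 (sub_ne_zero.2 hi))
        exact ⟨r', _, h1, hF.mono _ _ _ _ le_rfl hs (min_le_left _ _) h2, h3,
          ⟨i, min_le_right _ _⟩, h5⟩
      · rintro ⟨r', s', h1, h2, h3, ⟨i, hi⟩, h5⟩
        refine ⟨h1, ⟨r', s', h2⟩, h3, fun h => ?_, h5⟩
        have := (hF.pos _ _ _ h2).trans_le hi
        rw [abs_pos, sub_ne_zero] at this
        exact this (congrFun h i)⟩)
    (fun s t _ hst => Set.image_mono fun w hw =>
      ⟨hw.1, hw.2.1, hw.2.2.1, hw.2.2.2.1, fun i => (hw.2.2.2.2 i).trans hst⟩)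
    hVo hVne (fun b hb => by
      obtain ⟨t, ht, h⟩ := H.exists_isolating_radius hF hKdef hKb hKA σ (hV b hb)
      refine ⟨t, ht, ?_⟩
      rintro ⟨w, ⟨h1, h2, h3, h4, h5⟩, rfl⟩
      exact h4 (h _ _ h1 rfl h2 h3.symm h5))
  have hiso : ∀ y y', y ∈ K → y' ∈ A → y ∘ σ ∈ W → y' ∘ σ = y ∘ σ →
      (∀ i, |y i - y' i| ≤ t) → y = y' := by
    intro y y' hy hy' hyW hyy' hle
    by_contra hne
    exact hW _ hyW ⟨Sum.elim y y', ⟨hy, hy', hyy'.symm, hne, hle⟩, rfl⟩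
  obtain ⟨δ, hδ, hδW⟩ := exists_closedCube_subset hWo hb
  -- The choice `t₁ < t₂` puts the closed box of radius `t₁` inside the open cube of radius `t₂`; `2
  -- * t₂ < t` keeps points of that cube within the isolating radius of each other.
  obtain ⟨t₂, ht₂, ht₂t⟩ := exists_pos_add_self_lt ht
  obtain ⟨t₁, ht₁, ht₁₂⟩ := exists_between ht₂
  obtain ⟨T, x, hx⟩ := H.exists_box (K := K ∩ {y | y ∘ σ ∈ closedCube b δ})
    (.and hKdef ((H.closedCube b δ).mem_set fun _ => .proj _))
    (hKc.inter ((isClosed_closedCube b δ).preimage (f := fun y : Fin n → R => y ∘ σ)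
      (by fun_prop)))
    (let ⟨a, c, h⟩ := hKb; ⟨a, c, Set.inter_subset_left.trans h⟩) σ
    ⟨b, interior_maximal (fun z hz => by
      have hzC := cube_subset_closedCube b δ hz
      obtain ⟨y, hy, rfl⟩ := interior_subset (hVK (hWV (hδW hzC)))
      exact ⟨y, ⟨hy, hzC⟩, rfl⟩) (isOpen_cube b δ) (mem_cube_self hδ)⟩ ht₁
  set B := interior ((· ∘ σ) '' (K ∩ {y | y ∘ σ ∈ closedCube b δ} ∩
    {y | ∀ i, |y i - T i| ≤ t₁}))
  have hO : IsOpen {y : Fin n → R | y ∘ σ ∈ B ∧ y ∈ cube T t₂} :=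
    (isOpen_interior.preimage (f := fun y : Fin n → R => y ∘ σ) (by fun_prop)).inter
      (isOpen_cube T t₂)
  -- Over each base point in `B` there is a point of `K` in the box, and isolation lets `A` have no
  -- other point of the cube there.
  have hAO : A ∩ {y : Fin n → R | y ∘ σ ∈ B ∧ y ∈ cube T t₂} ⊆ K := by
    rintro y ⟨hyA, hyB, hyT⟩
    obtain ⟨k, ⟨⟨hkK, hkC⟩, hkT⟩, hky⟩ := interior_subset hyB
    have := hiso k y hkK hyA (hδW hkC) hky.symm fun i => by
      calc |k i - y i| ≤ |k i - T i| + |T i - y i| := abs_sub_le _ _ _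
        _ ≤ t₂ + t₂ := add_le_add ((hkT i).trans ht₁₂.le) (abs_sub_comm (y i) _ ▸ (hyT i).le)
        _ ≤ t := ht₂t.le
    exact this ▸ hkK
  obtain ⟨k, ⟨⟨hkK, -⟩, hkT⟩, rfl⟩ := interior_subset hx
  -- Since `k` is in the closure of `closure A \ A`, its neighbourhood contains a point `p` of
  -- `closure A` outside `A`. But near `p` the set `A` lies in the closed set `K`, so `p ∈ K ⊆ A`.
  obtain ⟨p, hpO, hpA, hpA'⟩ := mem_closure_iff.1 hkK.2 _ hO
    ⟨hx, fun i => (hkT i).trans_lt ht₁₂⟩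
  refine hpA' (hKA ?_)
  refine closure_minimal hAO hKc (mem_closure_iff.2 fun U hU hpU => ?_)
  obtain ⟨q, ⟨hqU, hqO⟩, hqA⟩ := mem_closure_iff.1 hpA _ (hU.inter hO) ⟨hpU, hpO⟩
  exact ⟨q, hqU, hqA, hqO⟩

end SmallDimension

/-! ### Induction on dimension and the theorem -/

section Constructible

theorem IsOpen.isBooleanCombinationOfOpens {α : Type*} [TopologicalSpace α] {U : Set α}
    (hU : IsOpen U) : IsBooleanCombinationOfOpens U :=
  BooleanSubalgebra.subset_closure hU

theorem IsClosed.isBooleanCombinationOfOpens {α : Type*} [TopologicalSpace α] {C : Set α}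
    (hC : IsClosed C) : IsBooleanCombinationOfOpens C := by
  have := BooleanSubalgebra.compl_mem hC.isOpen_compl.isBooleanCombinationOfOpens
  rwa [compl_compl] at this

variable {L : Language} {R : Type*} [L.Structure R] [AddCommGroup R] [LinearOrder R]
  [IsOrderedAddMonoid R] [DenselyOrdered R] [TopologicalSpace R] [OrderTopology R] [Nontrivial R]
  {n : ℕ}

theorem IsDSigmaSystem.isBooleanCombinationOfOpens (H : IsTameExpansion L R) (d : ℕ) :
    ∀ {F : R → R → Set (Fin n → R)}, IsDSigmaSystem L F → DimLT {y | ∃ r s, y ∈ F r s} d →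
      IsBooleanCombinationOfOpens {y | ∃ r s, y ∈ F r s} := by
  induction d with
  | zero =>
    intro F _ hdim
    have h : {y | ∃ r s, y ∈ F r s} = ∅ := by
      rw [Set.eq_empty_iff_forall_notMem]
      intro y hy
      -- The projection of a nonempty set to `R ^ 0` is the whole one-point space, which is open.
      have h := hdim Fin.elim0 fun i => i.elim0
      have huniv : (· ∘ Fin.elim0) '' {y | ∃ r s, y ∈ F r s} = (Set.univ : Set (Fin 0 → R)) :=
        Set.eq_univ_of_forall fun z => ⟨y, hy, Subsingleton.elim _ _⟩
      rw [huniv, interior_univ] at h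
      exact (h ▸ Set.notMem_empty default : default ∉ Set.univ) trivial
    rw [h]
    exact isOpen_empty.isBooleanCombinationOfOpens
  | succ d ih =>
    intro F hF hdim
    set A := {y | ∃ r s, y ∈ F r s} with hA
    have hFC := hF.inter_const_closure_frontier H
    have hunion : {y | ∃ r s, y ∈ F r s ∩ closure (closure A \ A)} =
        A ∩ closure (closure A \ A) := by
      ext y
      simp [hA]
    have h := ih hFC (hunion ▸ hdim.inter_closure_frontier H hF)
    have hsplit : A = (closure A \ closure (closure A \ A)) ∪ (A ∩ closure (closure A \ A)) := by
      ext y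
      by_cases hy : y ∈ closure (closure A \ A)
      · simp [hy]
      · simp only [Set.mem_union, Set.mem_sdiff, hy, not_false_eq_true, and_true, Set.mem_inter_iff,
          and_false, or_false]
        refine ⟨fun h => subset_closure h, fun h => ?_⟩
        by_contra hyA
        exact hy (subset_closure ⟨h, hyA⟩)
    rw [hsplit]
    exact BooleanSubalgebra.sup_mem (BooleanSubalgebra.sdiff_mem
      isClosed_closure.isBooleanCombinationOfOpens isClosed_closure.isBooleanCombinationOfOpens)
      (hunion ▸ h)

/-- Declaring the members empty unless both indices are positive leaves the union unchanged and lets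
the indices range over all of `R`. -/
theorem IsDSigma.exists_system (H : IsTameExpansion L R) {X : Set (Fin n → R)}
    (hX : IsDSigma L X) : ∃ F, IsDSigmaSystem L F ∧ X = {y | ∃ r s, y ∈ F r s} := by
  obtain ⟨-, F, hF, rfl⟩ := hX
  obtain ⟨𝒳, h𝒳, hF𝒳⟩ := hF.definable_family
  refine ⟨fun r s => {y | 0 < r ∧ 0 < s ∧ y ∈ F r s}, ?_, ?_⟩
  · refine ⟨?_, fun r s => ?_, fun r s => ?_, fun r s y hy => hy.2.1, ?_⟩
    · have h : DefinableRel L fun w : Fin 2 ⊕ Fin n → R => 0 < w (.inl 0) ∧ 0 < w (.inl 1) ∧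
          w ∈ 𝒳 := .and (H.lt (.const _) (.proj _)) (.and (H.lt (.const _) (.proj _)) h𝒳)
      refine h.congr fun w => and_congr_right fun hr => and_congr_right fun hs => ?_
      have hw : Sum.elim ![w (.inl 0), w (.inl 1)] (fun i => w (.inr i)) = w := by
        ext (i | i)
        · fin_cases i <;> rfl
        · rfl
      rw [hF𝒳 _ _ hr hs, Set.mem_ofPred_eq, hw]
    · by_cases h : 0 < r ∧ 0 < s
      · simpa [h.1, h.2] using (hF.isCBD r s h.1 h.2).isClosed
      · convert isClosed_empty
        exact Set.eq_empty_of_forall_notMem fun y hy => h ⟨hy.1, hy.2.1⟩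
    · by_cases h : 0 < r ∧ 0 < s
      · obtain ⟨a, b, hab⟩ := (hF.isCBD r s h.1 h.2).bounded
        exact ⟨a, b, fun y hy => hab hy.2.2⟩
      · exact ⟨0, 0, fun y hy => absurd ⟨hy.1, hy.2.1⟩ h⟩
    · rintro r r' s s' hr hs' hs y ⟨h1, h2, hy⟩
      have hy' : y ∈ F r' s := by
        rcases hr.eq_or_lt with rfl | hr
        exacts [hy, hF.increasing r r' s h1 hr h2 hy]
      refine ⟨h1.trans_le hr, hs', ?_⟩
      rcases hs.eq_or_lt with rfl | hs
      exacts [hy', hF.decreasing r' s' s (h1.trans_le hr) hs' hs hy']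
  · ext y
    rfl

end Constructible

theorem theorem4p1 {R : Type*} [AddCommGroup R] [LinearOrder R] [IsOrderedAddMonoid R]
    [DenselyOrdered R] [TopologicalSpace R] [OrderTopology R]
    (L : FirstOrder.Language) [L.Structure R]
    (hexp : IsOrderedGroupExpansion L (R := R))
    (hcomplete : IsDefinablyComplete L R)
    (hclosed : ClosedDiscreteOrInterval L R)
    (n : ℕ) (X : Set (Fin n → R)) (hX : IsDSigma L X) :
    IsBooleanCombinationOfOpens X := by
  cases subsingleton_or_nontrivial R
  · exact (isOpen_discrete X).isBooleanCombinationOfOpens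
  · have H : IsTameExpansion L R := ⟨hexp, hcomplete, hclosed⟩
    obtain ⟨F, hF, rfl⟩ := hX.exists_system H
    -- At `n + 1` the dimension bound is vacuous, as `Fin (n + 1)` does not inject into `Fin n`.
    refine hF.isBooleanCombinationOfOpens H (n + 1) fun σ hσ => ?_
    simpa using Fintype.card_le_of_injective σ hσ
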